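/- **Setting.** Let $\mathbb{X}\subset\mathbb{Z}$ be an infinite alphabet (for instance $\mathbb{Z}$ or the positive integers) and let $\rho:\mathbb{X}\times\mathbb{X}\to[0,\infty)$ satisfy $\rho(x,y)=0$ if and only if $x=y$. Assume that $\rho$ is unbounded and consistent with the Euclidean norm: for every $K>0$ there is $\epsilon>0$ such that $\rho(i,j)\ge K$ whenever $|i-j|\ge\epsilon$. Put $\rho_n(x^n,y^n)=\frac1n\sum_{i=1}^n\rho(x_i,y_i)$ on $\mathbb{X}^n$. A *$D$-semifaithful code of length $n$ at distortion $d>0$* is a triple $\xi_n=(\phi_n,\mathcal{C}_n,\mathcal{D}_n)$ where $\phi_n:\mathbb{X}^n\to\mathbb{X}^n$ has range $\mathcal{B}_n$ and satisfies $\rho_n(x^n,\phi_n(x^n))\le d$ for all $x^n$, $\mathcal{C}_n:\mathcal{B}_n\to\bigcup_{k\ge1}\{0,1\}^k$ is prefix-free, and $\mathcal{D}_n$ is a decoder with $\mathcal{D}_n(\mathcal{C}_n(y))=y$ for $y\in\mathcal{B}_n$. It *fixes its prototypes* if $\phi_n(y)=y$ for all $y\in\mathcal{B}_n$. A *scheme*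 at distortion $d$ is a sequence $\{\xi_n\}$ of such codes, one for each length. For a probability $\mu$ on $\mathbb{X}$ with $n$-fold product $\mu^n$, let $$R(\xi_n,\mu^n)=\frac1n\,\mathbb{E}_{X^n\sim\mu^n}\big[\,\text{length of }\mathcal{C}_n(\phi_n(X^n))\,\big],\qquad \mathcal{R}_n(d,\mu^n)=\frac1n\inf_{\pi\in\mathcal{Q}_n(d)}\ \sum_{A\in\pi}\mu^n(A)\log_2\frac1{\mu^n(A)},$$ where $\mathcal{Q}_n(d)$ is the set of partitions $\pi$ of $\mathbb{X}^n$ such that each cell $A\in\pi$ contains a point $y^n$ with $\rho_n(x^n,y^n)\le d$ for all $x^n\in A$. Let $H(\mu)=\sum_x\mu(x)\log_2\frac1{\mu(x)}\in[0,\infty]$ be the entropy, and $\mathcal{H}(\mathbb{X})$ the set of probabilities on $\mathbb{X}$ with $H(\mu)<\infty$. For $f:\mathbb{X}\to[0,\infty)$ let $\Lambda_f$ be the set of probabilities $\mu$ on $\mathbb{X}$ with $\mu(x)\le f(x)$ for all $x$, and assume that $\Lambda_f\neq\emptyset$. In suprema of differences $R(\xi_n,\mu^n)-\mathcal{R}_n(d,\mu^n)$,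 sources for which both terms are infinite are disregarded. **Theorem.** (i) If $\sum_x f(x)=\infty$, then for every $d>0$, every scheme $\{\xi_n\}$ at distortion $d$ and every $n\ge1$, $$\sup_{\mu\in\Lambda_f}\big[R(\xi_n,\mu^n)-\mathcal{R}_n(d,\mu^n)\big]=\infty.$$ (ii) If $\sum_x f(x)<\infty$, then for every $d>0$ there is a scheme $\{\xi_n\}$ at distortion $d$, whose codes fix their prototypes, that is weakly minimax universal on $\Lambda_f\cap\mathcal{H}(\mathbb{X})$: $$\lim_{n\to\infty}\big[R(\xi_n,\mu^n)-\mathcal{R}_n(d,\mu^n)\big]=0\qquad\text{for every }\mu\in\Lambda_f\cap\mathcal{H}(\mathbb{X}).$$ (iii) One has $\sup_{\mu\in\Lambda_f}H(\mu)<\infty$ if and only if $\Lambda_f\subset\mathcal{H}(\mathbb{X})$, and in this case $\sum_x f(x)<\infty$. If this holds, the scheme $\{\xi_n\}$ in (ii) can be chosen so that it is also strongly minimax universal: $$\lim_{n\to\infty}\ \sup_{\mu\in\Lambda_f}\big[R(\xi_n,\mu^n)-\mathcal{R}_n(d,\mu^n)\big]=0.$$ -/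

import Mathlib

open MeasureTheory Filter Topology
open scoped NNReal ENNReal

noncomputable section

namespace Semifaithful

/-! ### Distortions -/

/-- A distortion function: nonnegative (by its codomain), and zero exactly on the diagonal. -/
def IsDistortion {X : Type*} (ρ : X → X → ℝ≥0) : Prop :=
  ∀ x y, ρ x y = 0 ↔ x = y

/-- An unbounded distortion on a set of integers, consistent with the Euclidean norm: at Euclidean
distance at least `ε` (that is, outside the open ball of radius `ε`) it is at least `K`. -/
def UnboundedConsistent {S : Set ℤ} (ρ : S → S → ℝ≥0) : Prop :=
  (∀ M : ℝ≥0, ∃ i j, M < ρ i j) ∧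
    ∀ K : ℝ≥0, 0 < K → ∃ ε : ℝ, 0 < ε ∧
      ∀ i j : S, ¬ (|(((i : ℤ) : ℝ)) - ((j : ℤ) : ℝ)| < ε) → K ≤ ρ i j

/-- The single-letter distortion between blocks of length `n`. -/
def blockDist {X : Type*} (ρ : X → X → ℝ≥0) (n : ℕ) (x y : Fin n → X) : ℝ≥0 :=
  (∑ i, ρ (x i) (y i)) / n

/-! ### Codes -/

/-- A `D`-semifaithful code of length `n` at distortion `d`: a quantizer, a prefix-free binary
encoder with nonempty codewords on the range of the quantizer (the set of prototypes), and a
decoder that inverts the encoder. -/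
structure Code {X : Type*} (ρ : X → X → ℝ≥0) (d : ℝ≥0) (n : ℕ) where
  quantizer : (Fin n → X) → (Fin n → X)
  encoder : Set.range quantizer → List Bool
  decoder : List Bool → Set.range quantizer
  encoder_ne_nil : ∀ y, encoder y ≠ []
  prefix_free : ∀ y y', y ≠ y' → ¬ (encoder y <+: encoder y')
  decoder_encoder : ∀ y, decoder (encoder y) = y
  dist_le : ∀ x, blockDist ρ n x (quantizer x) ≤ d

/-- Every prototype lies in its own quantization cell. -/
def Code.FixesPrototypes {X : Type*} {ρ : X → X → ℝ≥0} {d : ℝ≥0} {n : ℕ}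
    (ξ : Code ρ d n) : Prop :=
  ∀ y ∈ Set.range ξ.quantizer, ξ.quantizer y = y

/-- A coding scheme at distortion `d`: one code for each block length. -/
abbrev Scheme {X : Type*} (ρ : X → X → ℝ≥0) (d : ℝ≥0) : Type _ :=
  (n : ℕ) → Code ρ d n

/-- The number of bits that the code spends on the block `x`. -/
def Code.length {X : Type*} {ρ : X → X → ℝ≥0} {d : ℝ≥0} {n : ℕ}
    (ξ : Code ρ d n) (x : Fin n → X) : ℕ :=
  (ξ.encoder ⟨ξ.quantizer x, x, rfl⟩).length

/-! ### Sources, rates and entropies -/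

/-- The `n`-fold product of `μ`: the law of a block of a stationary memoryless source. -/
def iid {X : Type*} [MeasurableSpace X] (μ : PMF X) (n : ℕ) : Measure (Fin n → X) :=
  Measure.pi fun _ => μ.toMeasure

/-- Average rate of the code, in bits per sample. -/
def Code.rate {X : Type*} [MeasurableSpace X] {ρ : X → X → ℝ≥0} {d : ℝ≥0} {n : ℕ}
    (ξ : Code ρ d n) (μ : PMF X) : ℝ≥0∞ :=
  (∫⁻ x, (ξ.length x : ℝ≥0∞) ∂(iid μ n)) / n

/-- The term `- p log₂ p` of an entropy (nonnegative for a probability `p`). -/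
def entTerm (p : ℝ≥0∞) : ℝ≥0∞ :=
  ENNReal.ofReal (Real.negMulLog p.toReal / Real.log 2)

/-- Shannon entropy in bits, possibly infinite. -/
def entropy {X : Type*} (μ : PMF X) : ℝ≥0∞ :=
  ∑' x, entTerm (μ x)

/-- Entropy, in bits, of a measure restricted to the cells of a partition. -/
def cellEntropy {Y : Type*} [MeasurableSpace Y] (m : Measure Y) (π : Set (Set Y)) : ℝ≥0∞ :=
  ∑' A : π, entTerm (m (A : Set Y))

/-- The partitions of the space of blocks each of whose cells contains a point within distortion
`d` of the whole cell. -/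
def coveringPartitions {X : Type*} (ρ : X → X → ℝ≥0) (d : ℝ≥0) (n : ℕ) :
    Set (Set (Set (Fin n → X))) :=
  {π | Setoid.IsPartition π ∧ ∀ A ∈ π, ∃ y ∈ A, ∀ x ∈ A, blockDist ρ n x y ≤ d}

/-- The optimal entropy, in bits per sample, of a covering partition for a known source. -/
def optRate {X : Type*} [MeasurableSpace X] (ρ : X → X → ℝ≥0) (d : ℝ≥0) (n : ℕ)
    (μ : PMF X) : ℝ≥0∞ :=
  (⨅ π ∈ coveringPartitions ρ d n, cellEntropy (iid μ n) π) / n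

/-- Redundancy, in bits per sample. In the extended reals `⊤ - ⊤ = ⊥`, so that a source for which
both terms are infinite contributes nothing to a supremum of redundancies. -/
def Code.redundancy {X : Type*} [MeasurableSpace X] {ρ : X → X → ℝ≥0} {d : ℝ≥0} {n : ℕ}
    (ξ : Code ρ d n) (μ : PMF X) : EReal :=
  (ξ.rate μ : EReal) - (optRate ρ d n μ : EReal)

/-- The worst-case redundancy of a code over a family of sources. -/
def Code.worstRedundancy {X : Type*} [MeasurableSpace X] {ρ : X → X → ℝ≥0} {d : ℝ≥0} {n : ℕ}
    (ξ : Code ρ d n) (Λ : Set (PMF X)) : EReal :=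
  ⨆ μ ∈ Λ, ξ.redundancy μ

/-- The scheme has redundancy tending to zero for each source of the family. -/
def WeaklyMinimaxUniversal {X : Type*} [MeasurableSpace X] {ρ : X → X → ℝ≥0} {d : ℝ≥0}
    (ξ : Scheme ρ d) (Λ : Set (PMF X)) : Prop :=
  ∀ μ ∈ Λ, Tendsto (fun n => (ξ n).redundancy μ) atTop (𝓝 0)

/-- The worst-case redundancy of the scheme over the family tends to zero. -/
def StronglyMinimaxUniversal {X : Type*} [MeasurableSpace X] {ρ : X → X → ℝ≥0} {d : ℝ≥0}
    (ξ : Scheme ρ d) (Λ : Set (PMF X)) : Prop :=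
  Tendsto (fun n => (ξ n).worstRedundancy Λ) atTop (𝓝 0)

/-- The envelope family of `f`. -/
def envelopeFamily {X : Type*} (f : X → ℝ≥0) : Set (PMF X) :=
  {μ | ∀ x, μ x ≤ f x}

/-- The sources of finite entropy. -/
def finiteEntropy (X : Type*) : Set (PMF X) :=
  {μ | entropy μ < ⊤}

end Semifaithful

end

noncomputable section

namespace Semifaithful

/-! ### Prefix codes and the Kraft inequality -/

/-! Infinite mass. A quantization cell has boundedly many points, so the Kraft sum of a code over
all blocks converges (`tsum_length_ne_top`) and is below `2 ^ (-M n)` off some finite set of blocks.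
An envelope of infinite mass leaves room for a finitely supported source whose blocks avoid that
set. Gibbs' inequality then forces rate at least `H / n + M`, with `H` the entropy of the block law,
while the partition into singletons bounds the optimal rate by `H / n`.

Finite mass. A memoryless source gives equal probability to all blocks of a type, so a quantizer of
least total code length on each type class is optimal for all sources at once; the price is naming
the type (`exists_universal_quantizer`). On an infinite alphabet the type is named by counts on a
finite window `W` and a list of the symbols outside it, written with lengths `Z` such that `f ≤ 2 ^
C * 2 ^ (-Z)`. The outside symbols cost per sample a multiple of the tail of `E Z` beyond `W`; it
vanishes as `W` grows as soon as `E Z` is finite, and `E Z ≤ H(μ) + C`. A window growing slowly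
enough also makes the counts negligible.

Redundancy is nonnegative for codes that fix their prototypes, but gluing over types destroys this
property: a prototype may have another type than the blocks it represents. The remedy is to start
the prototypes with a symbol `s` outside `W`, and to copy exactly the blocks that start outside `W`.
The distortion caused by `s` is recovered by copying a bounded number of further symbols exactly
(`exists_marked_description`).

Uniformity. If all entropies below `f` are finite, a mixture argument bounds them, and the
normalization of `f` itself shows that `∑ f Z` is finite. The bound on the redundancy increases with
`μ`, so replacing `μ` by `f` gives one bound for the whole family. -/

/-- **Kraft's inequality** for a prefix-free code on an arbitrary type. -/
theorem kraft_sum_le_one {Y : Type*} (c : Y → List Bool) (hne : ∀ y, c y ≠ [])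
    (hpf : ∀ y y', y ≠ y' → ¬ (c y <+: c y')) :
    ∑' y, (2⁻¹ : ℝ≥0∞) ^ (c y).length ≤ 1 := by
  classical
  have hinj : Function.Injective c := fun y y' h => by
    by_contra hy
    exact hpf y y' hy (h ▸ List.prefix_refl _)
  rw [ENNReal.tsum_eq_iSup_sum]
  refine iSup_le fun s => ?_
  -- If two concatenations agree, their first words are prefixes of one list, hence comparable,
  -- hence equal, and can be cancelled. Nonempty words rule out a leftover.
  have hud : InformationTheory.UniquelyDecodable (↑(s.image c) : Set (List Bool)) := by
    intro L₁
    induction L₁ with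
    | nil =>
      intro L₂ _ h₂ h
      cases L₂ with
      | nil => rfl
      | cons w L =>
        have hw := h₂ w (by simp)
        obtain ⟨y, -, rfl⟩ := Finset.mem_image.1 (Finset.mem_coe.1 hw)
        simp [hne y] at h
    | cons w L ih =>
      intro L₂ h₁ h₂ h
      obtain ⟨y, hy, rfl⟩ := Finset.mem_image.1 (Finset.mem_coe.1 (h₁ w (by simp)))
      cases L₂ with
      | nil => simp [hne y] at h
      | cons w' L' =>
        obtain ⟨y', hy', rfl⟩ := Finset.mem_image.1 (Finset.mem_coe.1 (h₂ w' (by simp)))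
        have hyy : y = y' := by
          by_contra hyy
          simp only [List.flatten_cons] at h
          rcases List.prefix_or_prefix_of_prefix (List.prefix_append (c y) L.flatten)
            (h ▸ List.prefix_append (c y') L'.flatten) with h' | h'
          · exact hpf _ _ hyy h'
          · exact hpf _ _ (Ne.symm hyy) h'
        subst hyy
        simp only [List.flatten_cons, List.append_cancel_left_eq] at h
        rw [ih L' (fun w hw => h₁ w (by simp [hw])) (fun w hw => h₂ w (by simp [hw])) h]
  have h := InformationTheory.kraft_mcmillan_inequality hud
  rw [Finset.sum_image fun _ _ _ _ h => hinj h] at h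
  have h2 : ∑ y ∈ s, (2⁻¹ : ℝ≥0∞) ^ (c y).length
      = ENNReal.ofReal (∑ y ∈ s, (1 / (Fintype.card Bool : ℝ)) ^ (c y).length) := by
    rw [ENNReal.ofReal_sum_of_nonneg fun _ _ => by positivity]
    refine Finset.sum_congr rfl fun y _ => ?_
    rw [ENNReal.ofReal_pow (by positivity)]
    simp [ENNReal.ofReal_inv_of_pos]
  rw [h2]
  exact ENNReal.ofReal_le_one.2 h

/-- The `L`-bit binary expansion of `k`, most significant bit first. -/
def binaryWord (k L : ℕ) : List Bool :=
  List.ofFn fun i : Fin L => k.testBit (L - 1 - i)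

/-- Truncating a binary expansion is division by a power of two. Geometrically, the dyadic interval
of the longer word lies inside that of its prefix. -/
theorem eq_div_of_binaryWord_prefix {k k' L L' : ℕ} (hk : k < 2 ^ L) (hk' : k' < 2 ^ L')
    (h : binaryWord k L <+: binaryWord k' L') : L ≤ L' ∧ k = k' / 2 ^ (L' - L) := by
  have hL : L ≤ L' := by simpa [binaryWord] using h.length_le
  refine ⟨hL, Nat.eq_of_testBit_eq fun j => ?_⟩
  rw [Nat.testBit_div_two_pow]
  by_cases hj : j < L
  · have h1 : (binaryWord k L)[L - 1 - j]? = (binaryWord k' L')[L - 1 - j]? := by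
      obtain ⟨t, ht⟩ := h
      rw [← ht, List.getElem?_append_left]
      simp [binaryWord]
      omega
    rw [List.getElem?_eq_getElem (by simp [binaryWord]; omega),
      List.getElem?_eq_getElem (by simp [binaryWord]; omega)] at h1
    simp only [binaryWord, List.getElem_ofFn, Option.some.injEq] at h1
    convert h1 using 2 <;> omega
  · rw [Nat.testBit_lt_two_pow (lt_of_lt_of_le hk (Nat.pow_le_pow_right (by norm_num) (by omega))),
      Nat.testBit_lt_two_pow (lt_of_lt_of_le hk' (Nat.pow_le_pow_right (by norm_num) (by omega)))]

/-- A converse of Kraft's inequality on a countable type (Shannon-Fano-Elias coding). -/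
theorem exists_prefix_code {Y : Type*} [Countable Y] (l : Y → ℕ)
    (hl : ∑' y, (2⁻¹ : ℝ≥0∞) ^ l y ≤ 1) :
    ∃ c : Y → List Bool, (∀ y y', y ≠ y' → ¬ (c y <+: c y')) ∧ ∀ y, (c y).length = l y + 1 := by
  classical
  obtain ⟨e, he⟩ := exists_injective_nat Y
  set q : Y → ℝ := fun y => (2⁻¹ : ℝ) ^ l y with hq
  have hq0 : ∀ y, 0 < q y := fun y => by positivity
  have hqe : ∀ y, (2⁻¹ : ℝ≥0∞) ^ l y = ENNReal.ofReal (q y) := fun y => by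
    rw [hq, ENNReal.ofReal_pow (by positivity), ENNReal.ofReal_inv_of_pos (by norm_num)]
    simp
  simp only [hqe] at hl
  have hs : Summable q := by
    have := ENNReal.summable_toReal (ne_top_of_le_ne_top ENNReal.one_ne_top hl)
    simpa [ENNReal.toReal_ofReal (hq0 _).le] using this
  have hsum : ∑' y, q y ≤ 1 := by
    rw [← ENNReal.ofReal_tsum_of_nonneg (fun y => (hq0 y).le) hs] at hl
    exact ENNReal.ofReal_le_one.1 hl
  -- Left endpoints of disjoint intervals of length `q y`, laid end to end in `[0, 1]` in the order
  -- given by `e`.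
  let F : Y → ℝ := fun y => ∑' z, if e z < e y then q z else 0
  have hsF : ∀ y, Summable fun z => if e z < e y then q z else 0 := fun y =>
    hs.of_nonneg_of_le (fun z => by split_ifs <;> simp [(hq0 z).le])
      (fun z => by split_ifs <;> simp [(hq0 z).le])
  have hF0 : ∀ y, 0 ≤ F y := fun y => tsum_nonneg fun z => by split_ifs <;> simp [(hq0 z).le]
  have hstep : ∀ y, F y + q y = ∑' z, if e z ≤ e y then q z else 0 := fun y => by
    rw [show q y = ∑' z, if z = y then q z else 0 by simp]
    rw [← (hsF y).tsum_add (summable_of_ne_finset_zero (s := {y}) fun z hz => by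
      simp at hz; simp [hz])]
    refine tsum_congr fun z => ?_
    rcases lt_trichotomy (e z) (e y) with h | h | h
    · have : z ≠ y := fun h' => by simp [h'] at h
      simp [h, h.le, this]
    · simp [he h]
    · have : z ≠ y := fun h' => by simp [h'] at h
      simp [h.not_gt, h, this]
  have hsG : ∀ y, Summable fun z => if e z ≤ e y then q z else 0 := fun y =>
    hs.of_nonneg_of_le (fun z => by split_ifs <;> simp [(hq0 z).le])
      (fun z => by split_ifs <;> simp [(hq0 z).le])
  have hF1 : ∀ y, F y + q y ≤ 1 := fun y => by
    rw [hstep]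
    exact le_trans ((hsG y).tsum_le_tsum (fun z => by split_ifs <;> simp [(hq0 z).le]) hs) hsum
  have hdisj : ∀ y y', e y < e y' → F y + q y ≤ F y' := fun y y' h => by
    rw [hstep]
    refine (hsG y).tsum_le_tsum (fun z => ?_) (hsF y')
    by_cases hz : e z ≤ e y
    · simp [hz, hz.trans_lt h]
    · simp only [hz, if_false]
      split_ifs <;> simp [(hq0 z).le]
  -- The extra bit makes `q y` twice the dyadic mesh `2 ^ (-L y)`, so that the interval of `y`
  -- contains a whole dyadic interval, whose index is `k y`.
  let L : Y → ℕ := fun y => l y + 1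
  let k : Y → ℕ := fun y => ⌈F y * 2 ^ L y⌉₊
  have h2 : ∀ y, (0 : ℝ) < 2 ^ L y := fun y => by positivity
  have hqL : ∀ y, q y * 2 ^ L y = 2 := fun y => by
    simp only [hq, L, pow_succ, ← mul_assoc, ← mul_pow]
    norm_num
  have hk1 : ∀ y, F y * 2 ^ L y ≤ k y := fun y => Nat.le_ceil _
  have hk2 : ∀ y, (k y : ℝ) + 1 < (F y + q y) * 2 ^ L y := fun y => by
    have := Nat.ceil_lt_add_one (mul_nonneg (hF0 y) (h2 y).le)
    rw [add_mul, hqL]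
    linarith
  have hk3 : ∀ y, k y < 2 ^ L y := fun y => by
    have h1 := hk2 y
    have h3 := mul_le_mul_of_nonneg_right (hF1 y) (h2 y).le
    have : (k y : ℝ) < 2 ^ L y := by linarith
    exact_mod_cast this
  refine ⟨fun y => binaryWord (k y) (L y), fun y y' hyy h => ?_, fun y => by simp [binaryWord, L]⟩
  obtain ⟨hL, hk⟩ := eq_div_of_binaryWord_prefix (hk3 y) (hk3 y') h
  have hpow : (2 : ℝ) ^ L y' = 2 ^ L y * 2 ^ (L y' - L y) := by
    rw [← pow_add]; congr 1; omega
  have hp0 : (0 : ℝ) < 2 ^ (L y' - L y) := by positivity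
  have ha : (k y : ℝ) * 2 ^ (L y' - L y) ≤ k y' := by
    have := Nat.div_mul_le_self (k y') (2 ^ (L y' - L y))
    rw [← hk] at this
    exact_mod_cast this
  have hb : (k y' : ℝ) < (k y + 1) * 2 ^ (L y' - L y) := by
    have h3 : k y' / 2 ^ (L y' - L y) < k y + 1 := by omega
    rw [Nat.div_lt_iff_lt_mul (by positivity)] at h3
    exact_mod_cast h3
  -- A prefix would nest the two dyadic intervals, but they lie in disjoint intervals.
  rcases lt_trichotomy (e y) (e y') with h' | h' | h'
  · have h3 := mul_le_mul_of_nonneg_right (hdisj _ _ h') (h2 y').le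
    have h4 := mul_lt_mul_of_pos_right (hk2 y) hp0
    have h5 := hk1 y'
    rw [mul_assoc, ← hpow] at h4
    linarith
  · exact hyy (he h')
  · have h3 := mul_le_mul_of_nonneg_right (hdisj _ _ h') (h2 y').le
    have h4 := mul_le_mul_of_nonneg_right (hk1 y) hp0.le
    have h5 := hk2 y'
    rw [mul_assoc, ← hpow] at h4
    linarith

/-- If a countable set of descriptions satisfies Kraft's inequality, so do the lengths of the
shortest descriptions of the described objects. -/
theorem exists_shortest_description {D Y : Type*} (g : D → Y) (l : D → ℕ)
    (hl : ∑' d, (2⁻¹ : ℝ≥0∞) ^ l d ≤ 1) :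
    ∃ l' : Y → ℕ, ∑' y : Set.range g, (2⁻¹ : ℝ≥0∞) ^ l' y ≤ 1 ∧ ∀ d, l' (g d) ≤ l d := by
  classical
  have h1 : ∀ y : Set.range g, ∃ d, g d = y ∧ ∀ d', g d' = y → l d ≤ l d' := fun y => by
    obtain ⟨d, hd⟩ := y.2
    have hex : ∃ k, ∃ d, g d = y ∧ l d = k := ⟨_, d, hd, rfl⟩
    obtain ⟨d₀, hd₀, hk⟩ := Nat.find_spec hex
    exact ⟨d₀, hd₀, fun d' hd' => hk ▸ Nat.find_min' hex ⟨d', hd', rfl⟩⟩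
  choose σ hσ hmin using h1
  refine ⟨fun y => if h : y ∈ Set.range g then l (σ ⟨y, h⟩) else 0, ?_, fun d => ?_⟩
  · have hinj : Function.Injective σ := fun y y' h => Subtype.ext (by rw [← hσ, h, hσ])
    refine le_trans (le_of_eq ?_) ((ENNReal.tsum_comp_le_tsum_of_injective hinj
      fun d => (2⁻¹ : ℝ≥0∞) ^ l d).trans hl)
    refine tsum_congr fun y => ?_
    simp [y.2]
  · have h : g d ∈ Set.range g := ⟨d, rfl⟩
    simp only [h, dif_pos]
    exact hmin ⟨g d, h⟩ d rfl

/-! ### Entropy and expected length -/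

/-- This is `log t ≤ t - 1` at `t = 2 ^ (m - l) / p`, multiplied by `p / log 2`. All terms stay on
their additive side because subtraction in `ℝ≥0∞` truncates. -/
theorem entTerm_add_le {p : ℝ≥0∞} (hp : p ≤ 1) (hp0 : p ≠ 0) (l m : ℕ) :
    entTerm p + m * p + ENNReal.ofReal (1 / Real.log 2) * p
      ≤ p * l + ENNReal.ofReal (1 / Real.log 2) * (2 ^ m * (2⁻¹ : ℝ≥0∞) ^ l) := by
  obtain ⟨x, rfl⟩ : ∃ x : ℝ≥0, p = x := ⟨p.toNNReal, by
    rw [ENNReal.coe_toNNReal (ne_top_of_le_ne_top ENNReal.one_ne_top hp)]⟩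
  have hx0 : (0 : ℝ) < x := by
    have : x ≠ 0 := by simpa using hp0
    positivity
  have hx1 : (x : ℝ) ≤ 1 := by exact_mod_cast hp
  have hlog : 0 < Real.log 2 := Real.log_pos (by norm_num)
  set q : ℝ := 2 ^ m * (2⁻¹) ^ l with hq
  have hq0 : 0 < q := by positivity
  have hlq : Real.log q = (m - l) * Real.log 2 := by
    rw [hq, Real.log_mul (by positivity) (by positivity), Real.log_pow, Real.log_pow, Real.log_inv]
    ring
  have hqe : (2 ^ m * (2⁻¹ : ℝ≥0∞) ^ l) = ENNReal.ofReal q := by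
    rw [hq, ENNReal.ofReal_mul (by positivity), ENNReal.ofReal_pow (by norm_num),
      ENNReal.ofReal_pow (by positivity), ENNReal.ofReal_inv_of_pos (by norm_num)]
    simp
  have hxe : ((x : ℝ≥0) : ℝ≥0∞) = ENNReal.ofReal x := by simp
  have hn : ∀ k : ℕ, (k : ℝ≥0∞) = ENNReal.ofReal k := fun k => by simp
  have hneg : 0 ≤ Real.negMulLog x / Real.log 2 :=
    div_nonneg (Real.negMulLog_nonneg hx0.le hx1) hlog.le
  rw [entTerm, hqe, hn m, hn l, ENNReal.coe_toReal, hxe,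
    ← ENNReal.ofReal_mul (by positivity), ← ENNReal.ofReal_mul (by positivity),
    ← ENNReal.ofReal_mul (by positivity), ← ENNReal.ofReal_mul (by positivity),
    ← ENNReal.ofReal_add hneg (by positivity), ← ENNReal.ofReal_add (by positivity) (by positivity),
    ← ENNReal.ofReal_add (by positivity) (by positivity)]
  refine ENNReal.ofReal_le_ofReal ?_
  have hineq := Real.log_le_sub_one_of_pos (div_pos hq0 hx0)
  rw [Real.log_div hq0.ne' hx0.ne', hlq] at hineq
  have h2 := mul_le_mul_of_nonneg_left hineq hx0.le
  rw [show (x : ℝ) * (q / x - 1) = q - x by field_simp] at h2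
  rw [Real.negMulLog]
  have : (-(x:ℝ) * Real.log x + m * Real.log 2 * x + x) ≤ x * l * Real.log 2 + q := by
    linarith
  have h3 := div_le_div_of_nonneg_right this hlog.le
  calc _ = (-(x:ℝ) * Real.log x + m * Real.log 2 * x + x) / Real.log 2 := by field_simp
    _ ≤ _ := h3
    _ = _ := by field_simp

/-- **Gibbs' inequality**: lengths whose Kraft sum over the support of a probability is at most
`2 ^ (-m)` exceed the entropy by at least `m` on average. -/
theorem tsum_entTerm_add_le {Y : Type*} (p : Y → ℝ≥0∞) (hp : ∑' y, p y = 1) (l : Y → ℕ) (m : ℕ)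
    (hl : ∑' y : Function.support p, (2⁻¹ : ℝ≥0∞) ^ l y ≤ (2⁻¹ : ℝ≥0∞) ^ m) :
    ∑' y, entTerm (p y) + m ≤ ∑' y, p y * l y := by
  classical
  set c : ℝ≥0∞ := ENNReal.ofReal (1 / Real.log 2)
  have hpt : ∀ y, entTerm (p y) + m * p y + c * p y
      ≤ p y * l y + c * (2 ^ m * (Function.support p).indicator (fun y => (2⁻¹ : ℝ≥0∞) ^ l y) y) := by
    intro y
    by_cases hy : p y = 0
    · simp [hy, entTerm]
    · rw [Set.indicator_of_mem (by simpa using hy)]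
      exact entTerm_add_le (hp ▸ ENNReal.le_tsum y) hy _ _
  have h := ENNReal.tsum_le_tsum hpt
  simp only [ENNReal.tsum_add, ENNReal.tsum_mul_left, hp, mul_one] at h
  rw [← tsum_subtype] at h
  have h2 : (2 : ℝ≥0∞) ^ m * ∑' y : Function.support p, (2⁻¹ : ℝ≥0∞) ^ l y ≤ 1 := by
    refine (mul_le_mul_right hl _).trans (le_of_eq ?_)
    rw [← mul_pow, ENNReal.mul_inv_cancel (by norm_num) (by norm_num), one_pow]
  have h3 := h.trans (add_le_add_right (mul_le_mul_right h2 c) _)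
  rw [mul_one] at h3
  exact (ENNReal.add_le_add_iff_right ENNReal.ofReal_ne_top).1 h3

/-- Shannon's lengths. -/
theorem exists_shannon_lengths {Y : Type*} (p : Y → ℝ≥0∞) (hp : ∑' y, p y = 1) :
    ∃ l : Y → ℕ, ∑' y : Function.support p, (2⁻¹ : ℝ≥0∞) ^ l y ≤ 1 ∧
      ∑' y, p y * l y ≤ ∑' y, entTerm (p y) + 1 := by
  have hp1 : ∀ y, p y ≤ 1 := fun y => hp ▸ ENNReal.le_tsum y
  have hlog : 0 < Real.log 2 := Real.log_pos (by norm_num)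
  -- Since `Real.log 0 = 0`, null points get length `0`; this is why Kraft sums are taken over the
  -- support here and later on.
  let l : Y → ℕ := fun y => ⌈-Real.log (p y).toReal / Real.log 2⌉₊
  refine ⟨l, ?_, ?_⟩
  · rw [tsum_subtype (Function.support p) fun y => (2⁻¹ : ℝ≥0∞) ^ l y, ← hp]
    refine ENNReal.tsum_le_tsum fun y => ?_
    by_cases hy : p y = 0
    · simp [hy]
    rw [Set.indicator_of_mem (by simpa using hy)]
    have hx0 : 0 < (p y).toReal :=
      ENNReal.toReal_pos hy (ne_top_of_le_ne_top ENNReal.one_ne_top (hp1 y))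
    have h1 : (2⁻¹ : ℝ) ^ l y ≤ (p y).toReal := by
      have := Nat.le_ceil (-Real.log (p y).toReal / Real.log 2)
      rw [div_le_iff₀ hlog] at this
      rw [← Real.log_le_log_iff (by positivity) hx0, Real.log_pow, Real.log_inv]
      simp only [l]
      linarith
    calc (2⁻¹ : ℝ≥0∞) ^ l y = ENNReal.ofReal ((2⁻¹ : ℝ) ^ l y) := by
          rw [ENNReal.ofReal_pow (by positivity), ENNReal.ofReal_inv_of_pos (by norm_num)]
          simp
      _ ≤ ENNReal.ofReal (p y).toReal := ENNReal.ofReal_le_ofReal h1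
      _ = p y := ENNReal.ofReal_toReal (ne_top_of_le_ne_top ENNReal.one_ne_top (hp1 y))
  · calc ∑' y, p y * l y ≤ ∑' y, (entTerm (p y) + p y) := by
          refine ENNReal.tsum_le_tsum fun y => ?_
          have hpt := ne_top_of_le_ne_top ENNReal.one_ne_top (hp1 y)
          have hx1 : (p y).toReal ≤ 1 := ENNReal.toReal_mono ENNReal.one_ne_top (hp1 y)
          have hpe : p y = ENNReal.ofReal (p y).toReal := (ENNReal.ofReal_toReal hpt).symm
          rw [entTerm]
          nth_rw 1 [hpe]
          nth_rw 3 [hpe]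
          rw [← ENNReal.ofReal_natCast, ← ENNReal.ofReal_mul ENNReal.toReal_nonneg,
            ← ENNReal.ofReal_add (div_nonneg (Real.negMulLog_nonneg ENNReal.toReal_nonneg hx1)
              hlog.le) ENNReal.toReal_nonneg]
          refine ENNReal.ofReal_le_ofReal ?_
          have := Nat.ceil_lt_add_one (a := -Real.log (p y).toReal / Real.log 2)
            (div_nonneg (neg_nonneg.2 (Real.log_nonpos ENNReal.toReal_nonneg hx1)) hlog.le)
          have h2 := mul_le_mul_of_nonneg_left this.le (ENNReal.toReal_nonneg (a := p y))
          refine h2.trans (le_of_eq ?_)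
          rw [Real.negMulLog]
          ring
      _ = _ := by rw [ENNReal.tsum_add, hp]

/-! ### Sums over blocks and lists -/

theorem tsum_pi_fin_prod {X : Type*} (g : X → ℝ≥0∞) (n : ℕ) :
    ∑' v : Fin n → X, ∏ i, g (v i) = (∑' x, g x) ^ n := by
  induction n with
  | zero => simp
  | succ n ih =>
    rw [← (Fin.consEquiv fun _ => X).tsum_eq, ENNReal.tsum_prod']
    simp only [Fin.consEquiv_apply, Fin.prod_univ_succ, Fin.cons_zero, Fin.cons_succ,
      ENNReal.tsum_mul_left, ENNReal.tsum_mul_right]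
    rw [ih, pow_succ']

theorem tsum_pi_prod {ι X : Type*} [Fintype ι] (g : X → ℝ≥0∞) :
    ∑' v : ι → X, ∏ i, g (v i) = (∑' x, g x) ^ Fintype.card ι := by
  rw [← tsum_pi_fin_prod, ← ((Fintype.equivFin ι).arrowCongr (Equiv.refl X)).symm.tsum_eq]
  refine tsum_congr fun v => ?_
  rw [← (Fintype.equivFin ι).prod_comp]
  simp [Equiv.arrowCongr]

theorem tsum_pi_pow_sum_le_one {ι X : Type*} [Fintype ι] {Z : X → ℕ}
    (hZ : ∑' x, (2⁻¹ : ℝ≥0∞) ^ Z x ≤ 1) :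
    ∑' v : ι → X, (2⁻¹ : ℝ≥0∞) ^ (∑ i, Z (v i)) ≤ 1 := by
  simp only [← Finset.prod_pow_eq_pow_sum]
  rw [tsum_pi_prod (fun x => (2⁻¹ : ℝ≥0∞) ^ Z x)]
  exact pow_le_one' hZ _

/-- Lists of length `n` contribute at most `2 ^ (-n)`. The bound `1 / 2` on the Kraft sum of `Z`,
instead of `1`, is what makes the sum over all lengths converge. -/
theorem tsum_list_pow_sum_le_two {X : Type*} {Z : X → ℕ}
    (hZ : ∑' x, (2⁻¹ : ℝ≥0∞) ^ Z x ≤ 2⁻¹) :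
    ∑' t : List X, (2⁻¹ : ℝ≥0∞) ^ (t.map Z).sum ≤ 2 := by
  rw [← List.equivSigmaTuple.symm.tsum_eq, ENNReal.tsum_sigma']
  have h : ∀ n, ∑' v : Fin n → X,
      (2⁻¹ : ℝ≥0∞) ^ ((List.equivSigmaTuple.symm ⟨n, v⟩ : List X).map Z).sum ≤ 2⁻¹ ^ n := fun n => by
    have h1 : ∀ v : Fin n → X, (2⁻¹ : ℝ≥0∞) ^
        ((List.equivSigmaTuple.symm ⟨n, v⟩ : List X).map Z).sum = ∏ i, 2⁻¹ ^ Z (v i) := fun v => by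
      rw [Finset.prod_pow_eq_pow_sum]
      simp [List.equivSigmaTuple, List.sum_ofFn]
    simp only [h1]
    rw [tsum_pi_fin_prod (fun x => (2⁻¹ : ℝ≥0∞) ^ Z x)]
    exact pow_le_pow_left' hZ n
  refine (ENNReal.tsum_le_tsum h).trans (le_of_eq ?_)
  rw [ENNReal.tsum_geometric, ENNReal.one_sub_inv_two, inv_inv]

/-! ### Types -/

/-- The type of a block: the multiset of its symbols. -/
def blockType {X : Type*} {n : ℕ} (x : Fin n → X) : Multiset X := Finset.univ.val.map x

theorem card_blockType {X : Type*} {n : ℕ} (x : Fin n → X) : (blockType x).card = n := by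
  simp [blockType]

theorem mem_blockType {X : Type*} {n : ℕ} (x : Fin n → X) (i : Fin n) : x i ∈ blockType x := by
  simp [blockType]

open Classical in
/-- Length of a description of a type: counts for the symbols in `W`, and the list of the others. -/
def typeLength {X : Type*} (Z : X → ℕ) (W : Finset X) (L : ℕ) (T : Multiset X) : ℕ :=
  1 + W.card * L + ((T.filter (· ∉ W)).map Z).sum

/-- A type is determined by its counts on `W`, each one of `n + 1 ≤ 2 ^ L` values, and by any
listing of its other symbols. The leading bit in `typeLength` pays for the factor `2` of the lists.
-/
theorem kraft_typeLength {X : Type*} {Z : X → ℕ}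
    (hZ : ∑' x, (2⁻¹ : ℝ≥0∞) ^ Z x ≤ 2⁻¹) (W : Finset X) {n L : ℕ} (hL : n + 1 ≤ 2 ^ L) :
    ∑' T : {T : Multiset X // T.card = n}, (2⁻¹ : ℝ≥0∞) ^ typeLength Z W L T ≤ 1 := by
  classical
  let g : {T : Multiset X // T.card = n} → (W → Fin (n + 1)) × List X := fun T =>
    (fun a => ⟨T.1.count a.1, Nat.lt_succ_of_le ((Multiset.count_le_card _ _).trans_eq T.2)⟩,
      (T.1.filter (· ∉ W)).toList)
  have hg : Function.Injective g := by
    intro T T' h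
    simp only [g, Prod.mk.injEq] at h
    obtain ⟨h1, h2⟩ := h
    refine Subtype.ext (Multiset.ext.2 fun a => ?_)
    by_cases ha : a ∈ W
    · have := congrFun h1 ⟨a, ha⟩
      simpa using this
    · have h3 : T.1.filter (· ∉ W) = T'.1.filter (· ∉ W) := by
        rw [← Multiset.coe_toList (T.1.filter (· ∉ W)), h2, Multiset.coe_toList]
      have h4 := congrArg (Multiset.count a) h3
      rwa [Multiset.count_filter_of_pos (p := (· ∉ W)) ha,
        Multiset.count_filter_of_pos (p := (· ∉ W)) ha] at h4
  let F : (W → Fin (n + 1)) × List X → ℝ≥0∞ := fun p =>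
    2⁻¹ ^ (1 + W.card * L + (p.2.map Z).sum)
  have h1 : ∀ T : {T : Multiset X // T.card = n},
      (2⁻¹ : ℝ≥0∞) ^ typeLength Z W L T = F (g T) := fun T => by
    simp only [F, g, typeLength]
    congr 2
    conv_lhs => rw [← Multiset.coe_toList (T.1.filter (· ∉ W))]
    rw [Multiset.map_coe, Multiset.sum_coe]
  simp only [h1]
  refine (ENNReal.tsum_comp_le_tsum_of_injective hg F).trans ?_
  rw [ENNReal.tsum_prod']
  calc ∑' (c : W → Fin (n + 1)) (t : List X), F (c, t)
      = ∑' _ : W → Fin (n + 1), 2⁻¹ ^ 1 * 2⁻¹ ^ (W.card * L) *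
        ∑' t : List X, (2⁻¹ : ℝ≥0∞) ^ (t.map Z).sum := by
        simp only [F, pow_add, ENNReal.tsum_mul_left]
    _ ≤ ∑' _ : W → Fin (n + 1), 2⁻¹ ^ 1 * 2⁻¹ ^ (W.card * L) * 2 :=
        ENNReal.tsum_le_tsum fun _ => mul_le_mul_right (tsum_list_pow_sum_le_two hZ) _
    _ = ((n + 1 : ℕ) : ℝ≥0∞) ^ W.card * 2⁻¹ ^ (W.card * L) * (2⁻¹ * 2) := by
        rw [tsum_fintype, Finset.sum_const, Finset.card_univ, Fintype.card_fun, Fintype.card_fin,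
          Fintype.card_coe, nsmul_eq_mul]
        push_cast
        ring
    _ ≤ ((2 ^ L : ℕ) : ℝ≥0∞) ^ W.card * 2⁻¹ ^ (W.card * L) * (2⁻¹ * 2) := by
        gcongr
    _ = 1 := by
        rw [ENNReal.inv_mul_cancel (by norm_num) (by norm_num), mul_one]
        push_cast
        rw [← pow_mul, mul_comm L, ← mul_pow, ENNReal.mul_inv_cancel (by norm_num) (by norm_num),
          one_pow]

theorem typeLength_blockType {X : Type*} [DecidableEq X] (Z : X → ℕ) (W : Finset X) (L : ℕ) {n : ℕ}
    (x : Fin n → X) :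
    typeLength Z W L (blockType x) = 1 + W.card * L + ∑ i, if x i ∈ W then 0 else Z (x i) := by
  classical
  rw [typeLength, blockType, Multiset.filter_map, Multiset.map_map]
  congr 1
  rw [← Finset.filter_val, ← Finset.sum_eq_multiset_sum, Finset.sum_filter]
  refine Finset.sum_congr rfl fun i _ => ?_
  by_cases h : x i ∈ W <;> simp [h]

theorem finite_blockType_fiber {X : Type*} (n : ℕ) (T : Multiset X) :
    Finite {x : Fin n → X // blockType x = T} := by
  classical
  refine Set.Finite.to_subtype (s := {x : Fin n → X | blockType x = T})
    ((Set.Finite.pi' fun _ : Fin n => T.toFinset.finite_toSet).subset ?_)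
  intro x hx i
  simp only [Set.mem_ofPred_eq] at hx
  simpa [← hx] using mem_blockType x i

/-! ### Blocks of a memoryless source -/

section Iid

variable {X : Type*} [MeasurableSpace X] [MeasurableSingletonClass X]

instance (μ : PMF X) (n : ℕ) : IsProbabilityMeasure (iid μ n) := by
  unfold iid
  infer_instance

theorem iid_singleton (μ : PMF X) {n : ℕ} (x : Fin n → X) : iid μ n {x} = ∏ i, μ (x i) := by
  simp [iid, Measure.pi_singleton, PMF.toMeasure_apply_singleton]

theorem iid_singleton_eq_blockType (μ : PMF X) {n : ℕ} (x : Fin n → X) :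
    iid μ n {x} = ((blockType x).map μ).prod := by
  rw [iid_singleton, blockType, Multiset.map_map]
  rfl

variable [Countable X]

theorem measurable_block {n : ℕ} {E : Type*} [MeasurableSpace E] (h : (Fin n → X) → E) :
    Measurable h := measurable_of_countable h

theorem lintegral_toMeasure (μ : PMF X) (h : X → ℝ≥0∞) :
    ∫⁻ a, h a ∂μ.toMeasure = ∑' a, μ a * h a := by
  rw [lintegral_countable']
  exact tsum_congr fun a => by rw [PMF.toMeasure_apply_singleton _ _ (measurableSet_singleton a),
    mul_comm]

theorem lintegral_iid (μ : PMF X) {n : ℕ} (h : (Fin n → X) → ℝ≥0∞) :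
    ∫⁻ x, h x ∂iid μ n = ∑' x, iid μ n {x} * h x := by
  rw [lintegral_countable']
  exact tsum_congr fun a => mul_comm _ _

theorem tsum_iid_singleton (μ : PMF X) (n : ℕ) : ∑' x, iid μ n {x} = 1 := by
  have := lintegral_iid μ (n := n) fun _ => 1
  simpa using this.symm

theorem iid_apply (μ : PMF X) (n : ℕ) (A : Set (Fin n → X)) :
    iid μ n A = ∑' x, A.indicator (fun x => iid μ n {x}) x :=
  (Measure.tsum_indicator_apply_singleton _ _ A.to_countable.measurableSet).symm

theorem lintegral_iid_eval (μ : PMF X) {n : ℕ} (i : Fin n) (h : X → ℝ≥0∞) :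
    ∫⁻ x, h (x i) ∂iid μ n = ∑' a, μ a * h a := by
  rw [← lintegral_toMeasure]
  exact (measurePreserving_eval (fun _ : Fin n => μ.toMeasure) i).lintegral_comp
    (measurable_of_countable h)

theorem lintegral_iid_sum (μ : PMF X) (n : ℕ) (h : X → ℝ≥0∞) :
    ∫⁻ x, ∑ i, h (x i) ∂iid μ n = n * ∑' a, μ a * h a := by
  rw [lintegral_finsetSum _ fun i _ => measurable_block _]
  simp [lintegral_iid_eval]

theorem lintegral_iid_mul (μ : PMF X) {n : ℕ} {i j : Fin n} (hij : i ≠ j) (g h : X → ℝ≥0∞) :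
    ∫⁻ x, g (x i) * h (x j) ∂iid μ n = (∑' a, μ a * g a) * ∑' a, μ a * h a := by
  rw [← lintegral_iid_eval μ i g, ← lintegral_iid_eval μ j h]
  refine ProbabilityTheory.lintegral_mul_eq_lintegral_mul_lintegral_of_indepFun''
    (measurable_block _).aemeasurable (measurable_block _).aemeasurable ?_
  have hind := ProbabilityTheory.iIndepFun_pi (μ := fun _ : Fin n => μ.toMeasure)
    (X := fun _ => id) (fun _ => aemeasurable_id)
  exact (hind.indepFun hij).comp (measurable_of_countable g) (measurable_of_countable h)

/-- Independence splits the terms with `j ≠ i`; the term `j = i` has to be kept apart. -/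
theorem lintegral_iid_mul_sum_le (μ : PMF X) {n : ℕ} (i : Fin n) (g h : X → ℝ≥0∞) :
    ∫⁻ x, g (x i) * ∑ j, h (x j) ∂iid μ n
      ≤ ∑' a, μ a * (g a * h a) + n * ((∑' a, μ a * g a) * ∑' a, μ a * h a) := by
  simp only [Finset.mul_sum]
  rw [lintegral_finsetSum _ fun i _ => measurable_block _, ← Finset.add_sum_erase _ _ (Finset.mem_univ i),
    lintegral_iid_eval μ i fun a => g a * h a]
  refine add_le_add_right ?_ _
  rw [Finset.sum_congr rfl fun j hj => lintegral_iid_mul μ (Finset.ne_of_mem_erase hj).symm g h,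
    Finset.sum_const, nsmul_eq_mul]
  gcongr
  simp

end Iid

/-! ### A quantizer that is optimal on every type class -/

theorem tsum_two_inv_pow_succ_le_one {Y : Type*} {e : Y → ℕ} (he : Function.Injective e) :
    ∑' y, (2⁻¹ : ℝ≥0∞) ^ (e y + 1) ≤ 1 :=
  (ENNReal.tsum_comp_le_tsum_of_injective he fun k => (2⁻¹ : ℝ≥0∞) ^ (k + 1)).trans (by
    simp only [pow_succ', ENNReal.tsum_mul_left]
    rw [ENNReal.tsum_geometric, ENNReal.one_sub_inv_two, inv_inv,
      ENNReal.inv_mul_cancel (by norm_num) (by norm_num)])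

/-- Among the quantizers and Kraft lengths on a finite set, some pair has least total length. -/
theorem exists_min_total_length {Y : Type*} [Countable Y] (R : Y → Y → Prop)
    (hR : ∀ x, ∃ y, R x y) (F : Set Y) [Fintype F] :
    ∃ (ψ : Y → Y) (l : Y → ℕ), (∀ x, R x (ψ x)) ∧ ∑' y : ψ '' F, (2⁻¹ : ℝ≥0∞) ^ l y ≤ 1 ∧
      ∀ (ψ' : Y → Y) (l' : Y → ℕ), (∀ x, R x (ψ' x)) →
        ∑' y : ψ' '' F, (2⁻¹ : ℝ≥0∞) ^ l' y ≤ 1 → ∑ x : F, l (ψ x) ≤ ∑ x : F, l' (ψ' x) := by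
  classical
  choose ψ₀ hψ₀ using hR
  obtain ⟨e, he⟩ := exists_injective_nat Y
  have hex : ∃ k, ∃ (ψ : Y → Y) (l : Y → ℕ), (∀ x, R x (ψ x)) ∧
      ∑' y : ψ '' F, (2⁻¹ : ℝ≥0∞) ^ l y ≤ 1 ∧ ∑ x : F, l (ψ x) = k :=
    ⟨_, ψ₀, fun y => e y + 1, hψ₀, tsum_two_inv_pow_succ_le_one
      (e := fun y : ψ₀ '' F => e y) (he.comp Subtype.val_injective), rfl⟩
  obtain ⟨ψ, l, h1, h2, h3⟩ := Nat.find_spec hex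
  exact ⟨ψ, l, h1, h2, fun ψ' l' h1' h2' => h3 ▸ Nat.find_min' hex ⟨ψ', l', h1', h2', rfl⟩⟩

/-- Gluing optimal quantizers on the type classes gives a quantizer which, up to the cost of
describing the type, is optimal for every memoryless source simultaneously. -/
theorem exists_universal_quantizer {X : Type*} [MeasurableSpace X] [MeasurableSingletonClass X]
    [Countable X] (n : ℕ) (R : (Fin n → X) → (Fin n → X) → Prop) (hR : ∀ x, ∃ y, R x y)
    (lT : Multiset X → ℕ)
    (hlT : ∑' T : {T : Multiset X // T.card = n}, (2⁻¹ : ℝ≥0∞) ^ lT T ≤ 1) :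
    ∃ (φ : (Fin n → X) → (Fin n → X)) (l : (Fin n → X) → ℕ), (∀ x, R x (φ x)) ∧
      ∑' y : Set.range φ, (2⁻¹ : ℝ≥0∞) ^ l y ≤ 1 ∧
      ∀ (μ : PMF X) (ψ : (Fin n → X) → (Fin n → X)) (l' : (Fin n → X) → ℕ), (∀ x, R x (ψ x)) →
        ∑' y : ψ '' {x | iid μ n {x} ≠ 0}, (2⁻¹ : ℝ≥0∞) ^ l' y ≤ 1 →
        ∫⁻ x, (l (φ x) : ℝ≥0∞) ∂iid μ n
          ≤ ∫⁻ x, ((lT (blockType x) : ℝ≥0∞) + l' (ψ x)) ∂iid μ n := by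
  classical
  have hfin : ∀ T : Multiset X, Finite {x : Fin n → X | blockType x = T} :=
    finite_blockType_fiber n
  let inst : ∀ T : Multiset X, Fintype {x : Fin n → X // blockType x = T} := fun T =>
    @Fintype.ofFinite _ (hfin T)
  let inst' : ∀ T : Multiset X, Fintype {x : Fin n → X | blockType x = T} := inst
  choose ψT l hψT hl hmin using fun T : Multiset X =>
    exists_min_total_length R hR {x : Fin n → X | blockType x = T}
  -- One block may serve as prototype for several types; it then has several descriptions, and the
  -- shortest one is kept.
  let D := Σ T : {T : Multiset X // T.card = n}, ψT T '' {x : Fin n → X | blockType x = T}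
  let g : D → (Fin n → X) := fun p => p.2
  obtain ⟨lφ, hlφ, hlφ'⟩ := exists_shortest_description g (fun p => lT p.1 + l p.1 p.2) (by
    rw [ENNReal.tsum_sigma']
    simp only [pow_add, ENNReal.tsum_mul_left]
    refine le_trans (ENNReal.tsum_le_tsum fun T => ?_) hlT
    exact (mul_le_mul_right (hl T) _).trans_eq (mul_one _))
  have hmem : ∀ x, ψT (blockType x) x ∈ ψT (blockType x) '' {x' | blockType x' = blockType x} :=
    fun x => ⟨x, rfl, rfl⟩
  refine ⟨fun x => ψT (blockType x) x, lφ, fun x => hψT _ x, ?_, fun μ ψ l' hψ hl' => ?_⟩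
  · refine le_trans (ENNReal.tsum_mono_subtype (fun y => (2⁻¹ : ℝ≥0∞) ^ lφ y) ?_) hlφ
    rintro _ ⟨x, rfl⟩
    exact ⟨⟨⟨blockType x, card_blockType x⟩, ⟨_, hmem x⟩⟩, rfl⟩
  · have h1 : ∀ x, lφ (ψT (blockType x) x) ≤ lT (blockType x) + l (blockType x) (ψT (blockType x) x) :=
      fun x => hlφ' ⟨⟨blockType x, card_blockType x⟩, ⟨_, hmem x⟩⟩
    calc ∫⁻ x, (lφ (ψT (blockType x) x) : ℝ≥0∞) ∂iid μ n
        ≤ ∫⁻ x, ((lT (blockType x) : ℝ≥0∞) + l (blockType x) (ψT (blockType x) x)) ∂iid μ n :=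
          lintegral_mono fun x => by rw [← Nat.cast_add]; exact Nat.cast_le.2 (h1 x)
      _ = ∫⁻ x, (lT (blockType x) : ℝ≥0∞) ∂iid μ n
          + ∫⁻ x, (l (blockType x) (ψT (blockType x) x) : ℝ≥0∞) ∂iid μ n :=
          lintegral_add_left (measurable_block _) _
      _ ≤ ∫⁻ x, (lT (blockType x) : ℝ≥0∞) ∂iid μ n + ∫⁻ x, (l' (ψ x) : ℝ≥0∞) ∂iid μ n := by
          refine add_le_add_right ?_ _
          rw [lintegral_iid, lintegral_iid,
            ← (Equiv.sigmaFiberEquiv (blockType : (Fin n → X) → Multiset X)).tsum_eq,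
            ← (Equiv.sigmaFiberEquiv (blockType : (Fin n → X) → Multiset X)).tsum_eq,
            ENNReal.tsum_sigma', ENNReal.tsum_sigma']
          refine ENNReal.tsum_le_tsum fun T => ?_
          have hw : ∀ x : {x : Fin n → X // blockType x = T},
              iid μ n {(x : Fin n → X)} = (T.map μ).prod := fun x => by
            rw [iid_singleton_eq_blockType, x.2]
          -- A class is either null or entirely in the support. In the second case the Kraft
          -- assumption on the image of the support covers the whole image of the class.
          by_cases hT : (T.map μ).prod = 0
          · simp [Equiv.sigmaFiberEquiv, hw, hT]
          have hK : ∑' y : ψ '' {x | blockType x = T}, (2⁻¹ : ℝ≥0∞) ^ l' y ≤ 1 := by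
            refine le_trans (ENNReal.tsum_mono_subtype (fun y => (2⁻¹ : ℝ≥0∞) ^ l' y) ?_) hl'
            refine Set.image_mono fun x hx => ?_
            simp only [Set.mem_ofPred_eq] at hx ⊢
            rw [hw ⟨x, hx⟩]
            exact hT
          have h2 := hmin T ψ l' hψ hK
          have h3 : ∀ x : {x : Fin n → X // blockType x = T},
              l (blockType x.1) (ψT (blockType x.1) x.1) = l T (ψT T x.1) := fun x => by rw [x.2]
          simp only [Equiv.sigmaFiberEquiv, Equiv.coe_fn_mk, hw, ENNReal.tsum_mul_left, h3]
          refine mul_le_mul_right ?_ _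
          have h4 : ∀ a : (Fin n → X) → ℕ, ∑' x : {x : Fin n → X // blockType x = T}, (a x.1 : ℝ≥0∞)
              = ((∑ x : {x : Fin n → X | blockType x = T}, a x.1 : ℕ) : ℝ≥0∞) := fun a => by
            push_cast
            exact tsum_fintype (L := .unconditional _) _
          rw [h4 fun x => l T (ψT T x), h4 fun x => l' (ψ x)]
          exact_mod_cast h2
      _ = _ := (lintegral_add_left (measurable_block _) _).symm

/-! ### Marking the prototypes -/

/-- Blocks whose first symbol lies outside `W` are reproduced exactly; the others are represented
within distortion `d` by a block whose first symbol is `s`. -/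
def IsMarked {X : Type*} (ρ : X → X → ℝ≥0) (d : ℝ≥0) {n : ℕ} [NeZero n] (W : Finset X) (s : X)
    (x y : Fin n → X) : Prop :=
  (x 0 ∉ W → y = x) ∧ (x 0 ∈ W → y 0 = s ∧ blockDist ρ n x y ≤ d)

theorem blockDist_self {X : Type*} {ρ : X → X → ℝ≥0} (hρ : IsDistortion ρ) (n : ℕ)
    (x : Fin n → X) : blockDist ρ n x x = 0 := by
  simp [blockDist, (hρ _ _).2]

theorem IsMarked.blockDist_le {X : Type*} {ρ : X → X → ℝ≥0} (hρ : IsDistortion ρ) {d : ℝ≥0} {n : ℕ}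
    [NeZero n] {W : Finset X} {s : X} {x y : Fin n → X} (h : IsMarked ρ d W s x y) :
    blockDist ρ n x y ≤ d := by
  by_cases hx : x 0 ∈ W
  · exact (h.2 hx).2
  · rw [h.1 hx, blockDist_self hρ]
    exact zero_le

/-- Every prototype begins outside `W`, either by being an exact copy or with the symbol `s`, so it
is itself copied exactly. -/
theorem fixes_of_isMarked {X : Type*} {ρ : X → X → ℝ≥0} {d : ℝ≥0} {n : ℕ}
    [NeZero n] {W : Finset X} {s : X} (hs : s ∉ W) {φ : (Fin n → X) → (Fin n → X)}
    (h : ∀ x, IsMarked ρ d W s x (φ x)) : ∀ y ∈ Set.range φ, φ y = y := by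
  rintro _ ⟨x, rfl⟩
  by_cases hx : x 0 ∈ W
  · exact (h (φ x)).1 (by rwa [((h x).2 hx).1])
  · rw [(h x).1 hx, (h x).1 hx]

/-- The cyclic interval of `m` indices that starts at `j`. -/
def cyclicInterval {n : ℕ} [NeZero n] (m : ℕ) (j : Fin n) : Finset (Fin n) :=
  Finset.univ.filter fun i => (i - j).val < m

theorem card_fin_filter_lt {n m : ℕ} (hm : m ≤ n) :
    (Finset.univ.filter fun k : Fin n => k.val < m).card = m := by
  rw [← Finset.card_map Fin.valEmbedding]
  convert Finset.card_range m
  ext k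
  simp only [Finset.mem_map, Finset.mem_filter, Finset.mem_univ, true_and, Finset.mem_range]
  exact ⟨fun ⟨a, ha, h⟩ => h ▸ ha, fun h => ⟨⟨k, h.trans_le hm⟩, h, rfl⟩⟩

theorem card_cyclicInterval {n : ℕ} [NeZero n] {m : ℕ} (hm : m ≤ n) (j : Fin n) :
    (cyclicInterval m j).card = m := by
  refine Eq.trans ?_ (card_fin_filter_lt hm)
  rw [← Finset.card_map (Equiv.subRight j).toEmbedding]
  congr 1
  ext k
  simp only [cyclicInterval, Finset.mem_map, Finset.mem_filter, Finset.mem_univ, true_and,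
    Equiv.coe_toEmbedding, Equiv.subRight_apply]
  exact ⟨fun ⟨a, ha, h⟩ => h ▸ ha, fun h => ⟨k + j, by simpa using h, by simp⟩⟩

/-- Some cyclic interval carries at least its share of a sum. -/
theorem exists_cyclicInterval_sum_le {n : ℕ} [NeZero n] {m : ℕ} (hm : m ≤ n) (r : Fin n → ℝ≥0) :
    ∃ j, m * ∑ i, r i ≤ n * ∑ i ∈ cyclicInterval m j, r i := by
  -- Double counting: each index lies in exactly `m` of the `n` cyclic intervals.
  have h : ∑ j, ∑ i ∈ cyclicInterval m j, r i = m * ∑ i, r i := by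
    simp only [cyclicInterval, Finset.sum_filter]
    rw [Finset.sum_comm, Finset.mul_sum]
    refine Finset.sum_congr rfl fun i _ => ?_
    rw [← Finset.sum_filter, Finset.sum_const, nsmul_eq_mul]
    congr 2
    refine Eq.trans ?_ (card_fin_filter_lt hm)
    rw [← Finset.card_map (Equiv.subLeft i).toEmbedding]
    congr 1
    ext k
    simp only [Finset.mem_map, Finset.mem_filter, Finset.mem_univ, true_and,
      Equiv.coe_toEmbedding, Equiv.subLeft_apply]
    exact ⟨fun ⟨a, ha, h⟩ => h ▸ ha, fun h => ⟨i - k, by simpa using h, by simp⟩⟩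
  obtain ⟨j, -, hj⟩ := Finset.exists_le_of_sum_le (s := (Finset.univ : Finset (Fin n)))
    (f := fun _ => (m : ℝ≥0) * ∑ i, r i) (g := fun j => n * ∑ i ∈ cyclicInterval m j, r i)
    Finset.univ_nonempty (by
      rw [← Finset.mul_sum Finset.univ (fun j => ∑ i ∈ cyclicInterval m j, r i) (n : ℝ≥0), h]
      simp)
  exact ⟨j, hj⟩

open Classical in
/-- Replace the symbols of `y` on `I` by `v`, and then the first symbol by `s`. -/
def markBlock {X : Type*} {n : ℕ} [NeZero n] (s : X) (y : Fin n → X) (I : Finset (Fin n))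
    (v : I → X) : Fin n → X :=
  fun i => if i = 0 then s else if h : i ∈ I then v ⟨i, h⟩ else y i

/-- Writing `s` first costs at most `K`, and exact copying on `I` removes the distortion there. Only
coordinatewise comparison is used, so no triangle inequality is needed. -/
theorem blockDist_markBlock_le {X : Type*} {ρ : X → X → ℝ≥0} (hρ : IsDistortion ρ) {d : ℝ≥0} {n : ℕ}
    [NeZero n] {s : X} {x y : Fin n → X} {I : Finset (Fin n)} {K : ℝ≥0} (hK : ρ (x 0) s ≤ K)
    (hI : K + ∑ i, ρ (x i) (y i) ≤ n * d + ∑ i ∈ I, ρ (x i) (y i)) :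
    blockDist ρ n x (markBlock s y I fun i => x i) ≤ d := by
  classical
  have hn : (0 : ℝ≥0) < n := by exact_mod_cast Nat.pos_of_ne_zero (NeZero.ne n)
  rw [blockDist, div_le_iff₀ hn, mul_comm d]
  have h1 : ∑ i, ρ (x i) (markBlock s y I (fun i => x i) i) + ∑ i ∈ I, ρ (x i) (y i)
      ≤ K + ∑ i, ρ (x i) (y i) := by
    rw [show K = ∑ i : Fin n, if i = 0 then K else 0 by simp,
      ← Finset.sum_filter_add_sum_filter_not Finset.univ (· ∈ I) fun i => ρ (x i) (y i),
      show Finset.univ.filter (· ∈ I) = I by ext; simp, add_comm (∑ i ∈ I, _), ← add_assoc]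
    refine add_le_add_left ?_ _
    rw [Finset.sum_filter, ← Finset.sum_add_distrib]
    refine Finset.sum_le_sum fun i _ => ?_
    by_cases hi : i = 0
    · subst hi
      simpa [markBlock] using le_add_right hK
    · by_cases hiI : i ∈ I <;> simp [markBlock, hi, hiI, (hρ _ _).2]
  exact le_of_add_le_add_right (h1.trans hI)

/-- From any description of a covering of the space of blocks, a description of a marked covering
whose length is not much larger. -/
theorem exists_marked_description {X : Type*} [DecidableEq X] {ρ : X → X → ℝ≥0}
    (hρ : IsDistortion ρ) {d : ℝ≥0} {n : ℕ} [NeZero n] {W : Finset X} {s : X} {K : ℝ≥0} {m L c : ℕ}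
    {Z : X → ℕ} (hZ : ∑' x, (2⁻¹ : ℝ≥0∞) ^ Z x ≤ 2⁻¹) (hL : n ≤ 2 ^ L) (hK : ∀ a ∈ W, ρ a s ≤ K)
    (hm : 2 * K ≤ m * d) (hn : 2 * K ≤ n * d) (hmn : m ≤ n) (hc : ∀ a ∈ W, Z a ≤ c)
    {D : Type*} (g : D → (Fin n → X)) (a : (Fin n → X) → D) (l : D → ℕ)
    (ha : ∀ x, blockDist ρ n x (g (a x)) ≤ d) (P : Set (Fin n → X))
    (hl : ∑' y : a '' P, (2⁻¹ : ℝ≥0∞) ^ l y ≤ 1) :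
    ∃ (ψ : (Fin n → X) → (Fin n → X)) (l' : (Fin n → X) → ℕ),
      (∀ x, IsMarked ρ d W s x (ψ x)) ∧ ∑' y : ψ '' P, (2⁻¹ : ℝ≥0∞) ^ l' y ≤ 1 ∧
      ∀ x ∈ P, l' (ψ x) ≤ 1 + l (a x) + L + m * c + (∑ i, if x i ∈ W then 0 else Z (x i))
        + if x 0 ∈ W then 0 else ∑ i, Z (x i) := by
  classical
  have hZ1 : ∑' x, (2⁻¹ : ℝ≥0∞) ^ Z x ≤ 1 := hZ.trans (by norm_num)
  have hn0 : (0 : ℝ≥0) < n := by exact_mod_cast Nat.pos_of_ne_zero (NeZero.ne n)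
  choose j hj using fun x : Fin n → X =>
    exists_cyclicInterval_sum_le hmn fun i => ρ (x i) (g (a x) i)
  have hdist : ∀ x, x 0 ∈ W → blockDist ρ n x
      (markBlock s (g (a x)) (cyclicInterval m (j x)) fun i => x i) ≤ d := fun x hx => by
    refine blockDist_markBlock_le hρ (hK _ hx) ?_
    have h1 : ∑ i, ρ (x i) (g (a x) i) ≤ n * d := by
      have := ha x
      rwa [blockDist, div_le_iff₀ hn0, mul_comm d] at this
    have h2 := hj x
    -- Either the budget `n d` has room for `K`, or the total distortion is at least `n d - K ≥ n d
    -- / 2`; then the best interval carries at least `m d / 2 ≥ K` of it.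
    rcases le_total (K + ∑ i, ρ (x i) (g (a x) i)) (n * d) with h | h
    · exact le_add_right h
    · rw [add_comm K]
      have h4 : K ≤ ∑ i ∈ cyclicInterval m (j x), ρ (x i) (g (a x) i) := by
        have h5 : (n : ℝ≥0) * d ≤ 2 * ∑ i, ρ (x i) (g (a x) i) := by
          have : 2 * ((n : ℝ≥0) * d) ≤ n * d + 2 * ∑ i, ρ (x i) (g (a x) i) :=
            calc 2 * ((n : ℝ≥0) * d) ≤ 2 * (K + ∑ i, ρ (x i) (g (a x) i)) := by gcongr
              _ = 2 * K + 2 * ∑ i, ρ (x i) (g (a x) i) := by ring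
              _ ≤ _ := by gcongr
          rw [two_mul] at this
          exact le_of_add_le_add_left this
        have h6 : (2 * n : ℝ≥0) * K ≤ (2 * n) * ∑ i ∈ cyclicInterval m (j x), ρ (x i) (g (a x) i) :=
          calc (2 * n : ℝ≥0) * K = n * (2 * K) := by ring
            _ ≤ n * (m * d) := by gcongr
            _ = m * (n * d) := by ring
            _ ≤ m * (2 * ∑ i, ρ (x i) (g (a x) i)) := by gcongr
            _ = 2 * (m * ∑ i, ρ (x i) (g (a x) i)) := by ring
            _ ≤ 2 * (n * ∑ i ∈ cyclicInterval m (j x), ρ (x i) (g (a x) i)) := by gcongr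
            _ = _ := by ring
        exact le_of_mul_le_mul_left h6 (by positivity)
      exact add_le_add h1 h4
  -- A block is described either verbatim, or by an old description, the start of a cyclic interval
  -- (`L` bits) and the exact symbols there; one bit tells which.
  let E := (Fin n → X) ⊕ (Σ p : (a '' P) × Fin n, (cyclicInterval m p.2 → X))
  let G : E → (Fin n → X) := Sum.elim id fun p => markBlock s (g p.1.1) _ p.2
  let lE : E → ℕ := Sum.elim (fun x => 1 + ∑ i, Z (x i))
    fun p => 1 + (l p.1.1 + L + ∑ i, Z (p.2 i))
  have hlE : ∑' e, (2⁻¹ : ℝ≥0∞) ^ lE e ≤ 1 := by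
    rw [Summable.tsum_sum ENNReal.summable ENNReal.summable, ENNReal.tsum_sigma',
      ENNReal.tsum_prod']
    simp only [lE, Sum.elim_inl, Sum.elim_inr, pow_add, ENNReal.tsum_mul_left, pow_one]
    calc _ ≤ (2⁻¹ : ℝ≥0∞) * 1 + 2⁻¹ * ∑' y : a '' P, (2⁻¹ ^ l y * 2⁻¹ ^ L * ∑' _ : Fin n, 1) := by
          gcongr
          · exact tsum_pi_pow_sum_le_one hZ1
          · exact tsum_pi_pow_sum_le_one hZ1
      _ ≤ (2⁻¹ : ℝ≥0∞) * 1 + 2⁻¹ * ∑' y : a '' P, (2⁻¹ ^ l y * 1) := by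
          refine add_le_add_right (mul_le_mul_right (ENNReal.tsum_le_tsum fun y => ?_) _) _
          rw [tsum_fintype, Finset.sum_const, Finset.card_univ, Fintype.card_fin, nsmul_eq_mul,
            mul_one, mul_assoc]
          gcongr
          calc (2⁻¹ : ℝ≥0∞) ^ L * n ≤ 2⁻¹ ^ L * ((2 ^ L : ℕ) : ℝ≥0∞) := by gcongr
            _ = 1 := by
              push_cast
              rw [← mul_pow, ENNReal.inv_mul_cancel (by norm_num) (by norm_num), one_pow]
      _ ≤ (2⁻¹ : ℝ≥0∞) * 1 + 2⁻¹ * 1 := by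
          gcongr
          simpa using hl
      _ = 1 := by rw [mul_one, ENNReal.inv_two_add_inv_two]
  obtain ⟨l', hl', hle⟩ := exists_shortest_description G lE hlE
  refine ⟨fun x => if x 0 ∈ W then
    markBlock s (g (a x)) (cyclicInterval m (j x)) (fun i => x i) else x, l', fun x => ?_, ?_, ?_⟩
  · by_cases hx : x 0 ∈ W
    · simp only [hx, if_true]
      exact ⟨fun h => absurd hx h, fun _ => ⟨by simp [markBlock], hdist x hx⟩⟩
    · simp only [hx, if_false]
      exact ⟨fun _ => rfl, fun h => absurd h hx⟩
  · refine le_trans (ENNReal.tsum_mono_subtype (fun y => (2⁻¹ : ℝ≥0∞) ^ l' y) ?_) hl'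
    rintro _ ⟨x, hxP, rfl⟩
    by_cases hx : x 0 ∈ W
    · exact ⟨Sum.inr ⟨(⟨a x, x, hxP, rfl⟩, j x), fun i => x i⟩, by simp [G, hx]⟩
    · exact ⟨Sum.inl x, by simp [G, hx]⟩
  · intro x hxP
    by_cases hx : x 0 ∈ W
    · simp only [hx, if_true]
      refine (hle (Sum.inr ⟨(⟨a x, x, hxP, rfl⟩, j x), fun i => x i⟩)).trans ?_
      simp only [lE, Sum.elim_inr]
      have h1 : ∑ i : cyclicInterval m (j x), Z (x i)
          ≤ m * c + ∑ i, if x i ∈ W then 0 else Z (x i) := by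
        rw [Finset.sum_coe_sort (cyclicInterval m (j x)) fun i => Z (x i)]
        calc ∑ i ∈ cyclicInterval m (j x), Z (x i)
            ≤ ∑ i ∈ cyclicInterval m (j x), (c + if x i ∈ W then 0 else Z (x i)) := by
              refine Finset.sum_le_sum fun i _ => ?_
              by_cases hi : x i ∈ W
              · simpa [hi] using hc _ hi
              · simp [hi]
          _ = m * c + ∑ i ∈ cyclicInterval m (j x), if x i ∈ W then 0 else Z (x i) := by
              rw [Finset.sum_add_distrib, Finset.sum_const, card_cyclicInterval hmn, smul_eq_mul]
          _ ≤ _ := by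
              gcongr
              exact Finset.subset_univ _
      omega
    · simp only [hx, if_false]
      refine (hle (Sum.inl x)).trans ?_
      simp only [lE, Sum.elim_inl]
      omega

/-! ### Codes from Kraft lengths, and the rate of a code -/

theorem exists_code {X : Type*} [Countable X] [Nonempty X] {ρ : X → X → ℝ≥0} {d : ℝ≥0} {n : ℕ}
    (φ : (Fin n → X) → (Fin n → X)) (hφ : ∀ x, blockDist ρ n x (φ x) ≤ d)
    (l : (Fin n → X) → ℕ) (hl : ∑' y : Set.range φ, (2⁻¹ : ℝ≥0∞) ^ l y ≤ 1) :
    ∃ ξ : Code ρ d n, ξ.quantizer = φ ∧ ∀ x, ξ.length x = l (φ x) + 1 := by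
  obtain ⟨c, hc, hlen⟩ := exists_prefix_code (fun y : Set.range φ => l y) hl
  have hinj : Function.Injective c := fun y y' h => by
    by_contra hy
    exact hc y y' hy (h ▸ List.prefix_refl _)
  have : Nonempty (Set.range φ) := (Set.range_nonempty φ).to_subtype
  exact ⟨⟨φ, c, Function.invFun c, fun y h => by simpa [h] using hlen y, hc,
    Function.leftInverse_invFun hinj, hφ⟩, rfl, fun x => hlen _⟩

/-- The cells of an idempotent quantizer form a covering partition. -/
theorem optRate_le_of_idempotent {X : Type*} [MeasurableSpace X] {ρ : X → X → ℝ≥0} {d : ℝ≥0} {n : ℕ}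
    (φ : (Fin n → X) → (Fin n → X)) (hφ : ∀ x, blockDist ρ n x (φ x) ≤ d)
    (hid : ∀ x, φ (φ x) = φ x) (μ : PMF X) :
    optRate ρ d n μ ≤ (∑' y, entTerm (iid μ n (φ ⁻¹' {y}))) / n := by
  refine ENNReal.div_le_div_right ?_ _
  let c : Set.range φ → Set (Fin n → X) := fun y => φ ⁻¹' {y.1}
  have hc : Function.Injective c := by
    rintro ⟨_, x, rfl⟩ ⟨_, x', rfl⟩ h
    have : x ∈ c ⟨φ x', x', rfl⟩ := h ▸ (rfl : φ x = φ x)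
    exact Subtype.ext this
  have hmem : Set.range c ∈ coveringPartitions ρ d n := by
    refine ⟨⟨?_, fun x => ?_⟩, ?_⟩
    · rintro ⟨⟨_, x, rfl⟩, h⟩
      have hx : x ∈ c ⟨φ x, x, rfl⟩ := rfl
      rw [h] at hx
      exact hx
    · refine ⟨c ⟨φ x, x, rfl⟩, ⟨⟨_, rfl⟩, rfl⟩, ?_⟩
      rintro _ ⟨⟨⟨y, hy⟩, rfl⟩, hx⟩
      have hx' : φ x = y := hx
      subst hx'
      rfl
    · rintro _ ⟨⟨_, x, rfl⟩, rfl⟩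
      refine ⟨φ x, hid x, fun x' hx' => ?_⟩
      have hx'' : φ x' = φ x := hx'
      exact hx'' ▸ hφ x'
  refine (iInf₂_le _ hmem).trans ?_
  calc cellEntropy (iid μ n) (Set.range c) = ∑' y, entTerm (iid μ n (c y)) :=
        tsum_range (fun A => entTerm (iid μ n A)) hc
    _ ≤ _ := ENNReal.tsum_comp_le_tsum_of_injective Subtype.val_injective
      fun y => entTerm (iid μ n (φ ⁻¹' {y}))

theorem optRate_le_entropy_iid {X : Type*} [MeasurableSpace X] {ρ : X → X → ℝ≥0}
    (hρ : IsDistortion ρ) (d : ℝ≥0) (n : ℕ) (μ : PMF X) : optRate ρ d n μ ≤ (∑' x, entTerm (iid μ n {x})) / n :=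
  optRate_le_of_idempotent id (fun x => by simp [blockDist_self hρ]) (fun _ => rfl) μ

section Rate

variable {X : Type*} [MeasurableSpace X] [MeasurableSingletonClass X] [Countable X]

theorem lintegral_iid_comp (μ : PMF X) {n : ℕ} {D : Type*} (a : (Fin n → X) → D) (h : D → ℝ≥0∞) :
    ∫⁻ x, h (a x) ∂iid μ n = ∑' z, iid μ n (a ⁻¹' {z}) * h z := by
  classical
  simp only [iid_apply μ n (a ⁻¹' _), ← ENNReal.tsum_mul_right]
  rw [ENNReal.tsum_comm, lintegral_iid]
  refine tsum_congr fun x => ?_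
  rw [tsum_eq_single (a x) fun z hz => by simp [Set.indicator, hz.symm]]
  simp

theorem tsum_iid_preimage (μ : PMF X) {n : ℕ} {D : Type*} (a : (Fin n → X) → D) :
    ∑' z, iid μ n (a ⁻¹' {z}) = 1 := by
  simpa using (lintegral_iid_comp μ a fun _ => 1).symm

theorem lintegral_iid_mono (μ : PMF X) {n : ℕ} {g h : (Fin n → X) → ℝ≥0∞}
    (hgh : ∀ x, iid μ n {x} ≠ 0 → g x ≤ h x) : ∫⁻ x, g x ∂iid μ n ≤ ∫⁻ x, h x ∂iid μ n := by
  rw [lintegral_iid, lintegral_iid]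
  refine ENNReal.tsum_le_tsum fun x => ?_
  by_cases hx : iid μ n {x} = 0
  · simp [hx]
  · exact mul_le_mul_right (hgh x hx) _

/-- When prototypes are fixed, the cells of the quantizer are an admissible partition, and Gibbs'
inequality bounds their entropy by the mean length. -/
theorem optRate_le_rate {ρ : X → X → ℝ≥0} {d : ℝ≥0} {n : ℕ} (ξ : Code ρ d n)
    (hξ : ξ.FixesPrototypes) (μ : PMF X) : optRate ρ d n μ ≤ ξ.rate μ := by
  classical
  refine (optRate_le_of_idempotent ξ.quantizer ξ.dist_le (fun x => hξ _ ⟨x, rfl⟩) μ).trans ?_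
  refine ENNReal.div_le_div_right ?_ _
  let l : (Fin n → X) → ℕ := fun y =>
    if h : y ∈ Set.range ξ.quantizer then (ξ.encoder ⟨y, h⟩).length else 0
  have hl : ∀ x, ξ.length x = l (ξ.quantizer x) := fun x => by
    simp [l, Code.length]
  simp only [hl]
  rw [lintegral_iid_comp μ ξ.quantizer fun y => (l y : ℝ≥0∞)]
  refine le_trans (le_of_eq ?_) (tsum_entTerm_add_le _ (tsum_iid_preimage μ ξ.quantizer) l 0 ?_)
  · simp
  · rw [pow_zero]
    refine le_trans (le_trans (ENNReal.tsum_mono_subtype (fun y => (2⁻¹ : ℝ≥0∞) ^ l y)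
      (t := Set.range ξ.quantizer) fun y hy => ?_) (le_of_eq ?_))
      (kraft_sum_le_one ξ.encoder ξ.encoder_ne_nil ξ.prefix_free)
    · by_contra hne
      refine hy ?_
      have : ξ.quantizer ⁻¹' {y} = ∅ := Set.eq_empty_of_forall_notMem fun x hx => hne ⟨x, hx⟩
      simp [this]
    · refine tsum_congr fun y => ?_
      have hy : y.1 ∈ Set.range ξ.quantizer := y.2
      simp only [l, hy, dif_pos]

theorem tsum_entTerm_iid_le (μ : PMF X) (n : ℕ) {Z : X → ℕ}
    (hZ : ∑' x, (2⁻¹ : ℝ≥0∞) ^ Z x ≤ 1) :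
    ∑' x, entTerm (iid μ n {x}) ≤ n * ∑' a, μ a * Z a := by
  have h := tsum_entTerm_add_le _ (tsum_iid_singleton μ n) (fun x => ∑ i, Z (x i)) 0
    (le_trans (ENNReal.tsum_comp_le_tsum_of_injective Subtype.val_injective
      fun x : Fin n → X => (2⁻¹ : ℝ≥0∞) ^ (∑ i, Z (x i))) (by
        rw [pow_zero]; exact tsum_pi_pow_sum_le_one hZ))
  rw [← lintegral_iid_sum μ n fun a => (Z a : ℝ≥0∞), lintegral_iid]
  simpa using h

/-- The redundancy of the code that describes the type, and then a prototype in an optimal marked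
quantization of the type class. -/
theorem exists_code_rate_le [DecidableEq X] {ρ : X → X → ℝ≥0}
    (hρ : IsDistortion ρ) {d : ℝ≥0} {n : ℕ} [NeZero n] {W : Finset X} {s : X} (hs : s ∉ W)
    {K : ℝ≥0} {m L c : ℕ} {Z : X → ℕ} (hZ : ∑' x, (2⁻¹ : ℝ≥0∞) ^ Z x ≤ 2⁻¹) (hL : n + 1 ≤ 2 ^ L)
    (hK : ∀ a ∈ W, ρ a s ≤ K) (hm : 2 * K ≤ m * d) (hn : 2 * K ≤ n * d) (hmn : m ≤ n)
    (hc : ∀ a ∈ W, Z a ≤ c) :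
    ∃ ξ : Code ρ d n, ξ.FixesPrototypes ∧ ∀ μ : PMF X,
      ξ.rate μ ≤ optRate ρ d n μ + (((4 + (W.card + 1) * L + m * c : ℕ) : ℝ≥0∞) / n
        + (∑' a, μ a * (if a ∈ W then 0 else Z a : ℕ)) * (3 + ∑' a, μ a * Z a)) := by
  have : Nonempty X := ⟨s⟩
  have hn1 : 1 ≤ n := Nat.pos_of_ne_zero (NeZero.ne n)
  have hR : ∀ x, ∃ y : Fin n → X, IsMarked ρ d W s x y := by
    obtain ⟨e, he⟩ := exists_injective_nat (Fin n → X)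
    obtain ⟨ψ, -, hψ, -⟩ := exists_marked_description hρ hZ (Nat.le_of_succ_le hL) hK hm hn hmn hc
      (id : (Fin n → X) → _) id (fun y => e y + 1) (fun x => by simp [blockDist_self hρ]) Set.univ
      (tsum_two_inv_pow_succ_le_one (e := fun y : (id '' Set.univ : Set (Fin n → X)) => e y)
        (he.comp Subtype.val_injective))
    exact fun x => ⟨ψ x, hψ x⟩
  obtain ⟨φ, l, hφ, hl, hopt⟩ := exists_universal_quantizer n (IsMarked ρ d W s) hR
    (typeLength Z W L) (kraft_typeLength hZ W hL)
  obtain ⟨ξ, hξφ, hξl⟩ := exists_code φ (fun x => (hφ x).blockDist_le hρ) l hl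
  refine ⟨ξ, ?_, fun μ => ?_⟩
  · unfold Code.FixesPrototypes
    rw [hξφ]
    exact fixes_of_isMarked hs hφ
  have hZ1 : ∀ a, 1 ≤ Z a := fun a => by
    by_contra h
    have h0 : Z a = 0 := by omega
    have h1 := (ENNReal.le_tsum a).trans hZ
    rw [h0, pow_zero] at h1
    exact absurd h1 (by norm_num)
  set τ : ℝ≥0∞ := ∑' a, μ a * (if a ∈ W then 0 else Z a : ℕ) with hτ
  set EZ : ℝ≥0∞ := ∑' a, μ a * Z a with hEZ
  -- The `4` collects one bit each from the type description, the flag of the marked description,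
  -- the rounding in Shannon's lengths and the prefix code. The three summands `τ` come from the
  -- type, the copied interval and the verbatim blocks.
  have key : ∀ π ∈ coveringPartitions ρ d n, ∫⁻ x, (ξ.length x : ℝ≥0∞) ∂iid μ n
      ≤ cellEntropy (iid μ n) π + ((4 + (W.card + 1) * L + m * c : ℕ) + n * (τ * (3 + EZ))) := by
    rintro π ⟨⟨-, hπ⟩, hcov⟩
    choose cell hcell huniq using hπ
    choose y hyA hy using hcov
    let a : (Fin n → X) → π := fun x => ⟨cell x, (hcell x).1⟩
    have ha : ∀ A : π, a ⁻¹' {A} = A.1 := fun A => by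
      ext x
      simp only [Set.mem_preimage, Set.mem_singleton_iff]
      exact ⟨fun h => h ▸ (hcell x).2, fun h => Subtype.ext (huniq x A.1 ⟨A.2, h⟩).symm⟩
    have hp : ∑' A : π, iid μ n A.1 = 1 := by
      rw [← tsum_iid_preimage μ a]
      exact tsum_congr fun A => by rw [ha]
    obtain ⟨lc, hlc, hlcE⟩ := exists_shannon_lengths (fun A : π => iid μ n A.1) hp
    obtain ⟨ψ, l', hψ, hl', hle⟩ := exists_marked_description hρ hZ (Nat.le_of_succ_le hL) hK hm hn
      hmn hc (fun A : π => y A.1 A.2) a lc (fun x => hy _ _ x (hcell x).2)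
      {x | iid μ n {x} ≠ 0} (by
        refine le_trans (ENNReal.tsum_mono_subtype (fun A : π => (2⁻¹ : ℝ≥0∞) ^ lc A) ?_) hlc
        rintro _ ⟨x, hx, rfl⟩ h0
        exact hx (measure_mono_null (Set.singleton_subset_iff.2 (hcell x).2) h0))
    have h1 : ∫⁻ x, (lc (a x) : ℝ≥0∞) ∂iid μ n ≤ cellEntropy (iid μ n) π + 1 := by
      rw [lintegral_iid_comp μ a fun A => (lc A : ℝ≥0∞)]
      simp only [ha]
      exact hlcE
    have h2 : ∫⁻ x, ∑ i, ((if x i ∈ W then 0 else Z (x i) : ℕ) : ℝ≥0∞) ∂iid μ n = n * τ :=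
      lintegral_iid_sum μ n fun a => ((if a ∈ W then 0 else Z a : ℕ) : ℝ≥0∞)
    -- Verbatim description is needed only if the first symbol is outside `W`. That has probability
    -- at most `τ` because `Z ≥ 1`.
    have h3 : ∫⁻ x, (if x 0 ∈ W then 0 else 1) * ∑ i, (Z (x i) : ℝ≥0∞) ∂iid μ n
        ≤ τ + n * (τ * EZ) := by
      refine (lintegral_iid_mul_sum_le μ 0 (fun a => if a ∈ W then 0 else 1)
        fun a => (Z a : ℝ≥0∞)).trans ?_
      have h4 : ∑' a, μ a * ((if a ∈ W then 0 else 1) * (Z a : ℝ≥0∞)) ≤ τ :=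
        ENNReal.tsum_le_tsum fun a => by split_ifs <;> simp
      have h5 : ∑' a, μ a * (if a ∈ W then 0 else 1) ≤ τ :=
        ENNReal.tsum_le_tsum fun a => mul_le_mul_right (by
          split_ifs
          · simp
          · exact_mod_cast hZ1 a) _
      gcongr
    have hpt : ∀ x, iid μ n {x} ≠ 0 → ((typeLength Z W L (blockType x) : ℝ≥0∞) + l' (ψ x))
        ≤ ((2 + (W.card + 1) * L + m * c : ℕ) : ℝ≥0∞)
          + (lc (a x) + (∑ i, ((if x i ∈ W then 0 else Z (x i) : ℕ) : ℝ≥0∞)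
          + (∑ i, ((if x i ∈ W then 0 else Z (x i) : ℕ) : ℝ≥0∞)
          + (if x 0 ∈ W then 0 else 1) * ∑ i, (Z (x i) : ℝ≥0∞)))) := by
      intro x hx
      have h4 := hle x hx
      have h5 : typeLength Z W L (blockType x) + l' (ψ x) ≤ (2 + (W.card + 1) * L + m * c)
          + (lc (a x) + ((∑ i, if x i ∈ W then 0 else Z (x i))
          + ((∑ i, if x i ∈ W then 0 else Z (x i))
          + if x 0 ∈ W then 0 else ∑ i, Z (x i)))) := by
        rw [typeLength_blockType, add_mul, one_mul]
        omega
      have h6 : ((typeLength Z W L (blockType x) + l' (ψ x) : ℕ) : ℝ≥0∞) ≤ _ := Nat.cast_le.2 h5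
      rw [Nat.cast_add] at h6
      refine h6.trans (le_of_eq ?_)
      by_cases h0 : x 0 ∈ W <;> simp [h0]
    calc ∫⁻ x, (ξ.length x : ℝ≥0∞) ∂iid μ n = ∫⁻ x, (l (φ x) : ℝ≥0∞) ∂iid μ n + 1 := by
          simp only [hξl, Nat.cast_add, Nat.cast_one]
          rw [lintegral_add_left (measurable_block _)]
          simp
      _ ≤ ∫⁻ x, (((2 + (W.card + 1) * L + m * c : ℕ) : ℝ≥0∞)
          + (lc (a x) + (∑ i, ((if x i ∈ W then 0 else Z (x i) : ℕ) : ℝ≥0∞)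
          + (∑ i, ((if x i ∈ W then 0 else Z (x i) : ℕ) : ℝ≥0∞)
          + (if x 0 ∈ W then 0 else 1) * ∑ i, (Z (x i) : ℝ≥0∞))))) ∂iid μ n + 1 := by
          refine add_le_add_left ?_ _
          exact (hopt μ ψ l' hψ hl').trans (lintegral_iid_mono μ hpt)
      _ = ((2 + (W.card + 1) * L + m * c : ℕ) : ℝ≥0∞) + (∫⁻ x, (lc (a x) : ℝ≥0∞) ∂iid μ n
          + (n * τ + (n * τ
          + ∫⁻ x, (if x 0 ∈ W then 0 else 1) * ∑ i, (Z (x i) : ℝ≥0∞) ∂iid μ n))) + 1 := by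
          rw [lintegral_add_left (measurable_block _), lintegral_add_left (measurable_block _),
            lintegral_add_left (measurable_block _), lintegral_add_left (measurable_block _), h2]
          simp
      _ ≤ ((2 + (W.card + 1) * L + m * c : ℕ) : ℝ≥0∞) + ((cellEntropy (iid μ n) π + 1)
          + (n * τ + (n * τ + (n * τ + n * (τ * EZ))))) + 1 := by
          gcongr
          refine h3.trans ?_
          gcongr
          exact le_mul_of_one_le_left zero_le (by exact_mod_cast hn1)
      _ = _ := by
          push_cast
          ring
  have hinf : ∫⁻ x, (ξ.length x : ℝ≥0∞) ∂iid μ n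
      ≤ (⨅ π ∈ coveringPartitions ρ d n, cellEntropy (iid μ n) π)
        + ((4 + (W.card + 1) * L + m * c : ℕ) + n * (τ * (3 + EZ))) := by
    rw [ENNReal.iInf_add]
    refine le_iInf fun π => ?_
    by_cases hπ : π ∈ coveringPartitions ρ d n
    · simpa [hπ] using key π hπ
    · simp [hπ]
  rw [Code.rate, optRate]
  refine (ENNReal.div_le_div_right hinf _).trans (le_of_eq ?_)
  rw [ENNReal.add_div, ENNReal.add_div, ENNReal.mul_div_right_comm,
    ENNReal.div_self (by exact_mod_cast NeZero.ne n) (ENNReal.natCast_ne_top n), one_mul]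

end Rate

/-! ### Envelope families -/

/-- If `p` is bounded by a multiple of `2 ^ (-l)`, then `p * l` is bounded by the entropy term. -/
theorem mul_le_entTerm_add {p : ℝ≥0∞} (hp : p ≤ 1) {l C : ℕ} (h : p ≤ 2 ^ C * (2⁻¹ : ℝ≥0∞) ^ l) :
    p * l ≤ entTerm p + C * p := by
  by_cases hp0 : p = 0
  · simp [hp0]
  have hpt := ne_top_of_le_ne_top ENNReal.one_ne_top hp
  have hx0 : 0 < p.toReal := ENNReal.toReal_pos hp0 hpt
  have hx1 : p.toReal ≤ 1 := ENNReal.toReal_mono ENNReal.one_ne_top hp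
  have hlog : 0 < Real.log 2 := Real.log_pos (by norm_num)
  have hx : p.toReal ≤ 2 ^ C * (2⁻¹ : ℝ) ^ l := by
    have := ENNReal.toReal_mono (ENNReal.mul_ne_top (by simp) (by simp)) h
    simpa using this
  have hlx : Real.log p.toReal ≤ (C - l) * Real.log 2 := by
    refine (Real.log_le_log hx0 hx).trans (le_of_eq ?_)
    rw [Real.log_mul (by positivity) (by positivity), Real.log_pow, Real.log_pow, Real.log_inv]
    ring
  have hpe : p = ENNReal.ofReal p.toReal := (ENNReal.ofReal_toReal hpt).symm
  rw [entTerm]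
  nth_rw 1 [hpe]
  nth_rw 3 [hpe]
  rw [← ENNReal.ofReal_natCast, ← ENNReal.ofReal_natCast, ← ENNReal.ofReal_mul hx0.le,
    ← ENNReal.ofReal_mul (by positivity),
    ← ENNReal.ofReal_add (div_nonneg (Real.negMulLog_nonneg hx0.le hx1) hlog.le) (by positivity)]
  refine ENNReal.ofReal_le_ofReal ?_
  rw [← sub_le_iff_le_add, le_div_iff₀ hlog, Real.negMulLog]
  have := mul_le_mul_of_nonneg_left hlx hx0.le
  linarith

/-- Lengths adapted to a summable envelope. -/
theorem exists_envelope_lengths {X : Type*} [Countable X] {f : X → ℝ≥0} (hf : Summable f) :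
    ∃ (Z : X → ℕ) (C : ℕ), ∑' x, (2⁻¹ : ℝ≥0∞) ^ Z x ≤ 2⁻¹ ∧
      ∀ x, (f x : ℝ≥0∞) ≤ 2 ^ C * 2⁻¹ ^ Z x := by
  -- A positive summable perturbation gives finite lengths even where `f` vanishes.
  obtain ⟨e, he, c, hc, -⟩ := NNReal.exists_pos_sum_of_countable one_ne_zero X
  have hg : Summable fun x => f x + e x := hf.add hc.summable
  set G : ℝ≥0 := ∑' x, (f x + e x) with hG
  obtain ⟨C, hC⟩ := pow_unbounded_of_one_lt (2 * G) (one_lt_two : (1 : ℝ≥0) < 2)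
  have h2C : (0 : ℝ≥0) < 2 ^ C := by positivity
  have hr1 : ∀ x, (f x + e x) / 2 ^ C ≤ 1 := fun x => by
    rw [div_le_one h2C]
    calc f x + e x ≤ G := hg.le_tsum x fun _ _ => zero_le
      _ ≤ 2 * G := le_mul_of_one_le_left zero_le one_le_two
      _ ≤ _ := hC.le
  have hr0 : ∀ x, 0 < (f x + e x) / 2 ^ C := fun x =>
    div_pos (lt_of_lt_of_le (he x) le_add_self) h2C
  choose Z hZ1 hZ2 using fun x => exists_nat_pow_near_of_lt_one (hr0 x) (hr1 x)
    (show (0 : ℝ≥0) < 2⁻¹ by positivity) (by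
      rw [← NNReal.coe_lt_coe]; norm_num)
  have hcast : ∀ k : ℕ, (2⁻¹ : ℝ≥0∞) ^ k = (((2⁻¹ : ℝ≥0) ^ k : ℝ≥0) : ℝ≥0∞) := fun k => by
    rw [ENNReal.coe_pow, ENNReal.coe_inv two_ne_zero]
    rfl
  refine ⟨fun x => Z x + 1, C + 1, ?_, fun x => ?_⟩
  · calc ∑' x, (2⁻¹ : ℝ≥0∞) ^ (Z x + 1) ≤ ∑' x, (((f x + e x) / 2 ^ C : ℝ≥0) : ℝ≥0∞) := by
          refine ENNReal.tsum_le_tsum fun x => ?_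
          rw [hcast]
          exact ENNReal.coe_le_coe.2 (hZ1 x).le
      _ = ((G / 2 ^ C : ℝ≥0) : ℝ≥0∞) := by
          rw [← ENNReal.coe_tsum (hg.div_const _), tsum_div_const]
      _ ≤ ((2⁻¹ : ℝ≥0) : ℝ≥0∞) := by
          refine ENNReal.coe_le_coe.2 ?_
          rw [div_le_iff₀ h2C, inv_mul_eq_div, le_div_iff₀ two_pos, mul_comm]
          exact hC.le
      _ = 2⁻¹ := by
          rw [ENNReal.coe_inv two_ne_zero]
          rfl
  · have h1 : f x ≤ 2 ^ (C + 1) * 2⁻¹ ^ (Z x + 1) :=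
      calc f x ≤ f x + e x := le_self_add
        _ = 2 ^ C * ((f x + e x) / 2 ^ C) := (mul_div_cancel₀ _ h2C.ne').symm
        _ ≤ 2 ^ C * 2⁻¹ ^ Z x := by gcongr; exact hZ2 x
        _ = 2 ^ (C + 1) * 2⁻¹ ^ (Z x + 1) := by
          rw [pow_succ, pow_succ, mul_mul_mul_comm, mul_inv_cancel₀ two_ne_zero, mul_one]
    rw [hcast]
    exact_mod_cast ENNReal.coe_le_coe.2 h1

theorem tsum_mul_le_entropy_add {X : Type*} (μ : PMF X) {Z : X → ℕ} {C : ℕ}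
    (h : ∀ x, μ x ≤ 2 ^ C * 2⁻¹ ^ Z x) : ∑' x, μ x * Z x ≤ entropy μ + C := by
  refine (ENNReal.tsum_le_tsum fun x => mul_le_entTerm_add (μ.coe_le_one x) (h x)).trans ?_
  rw [ENNReal.tsum_add, ENNReal.tsum_mul_left, μ.tsum_coe, mul_one, entropy]

theorem summable_of_eventuallyEq_cofinite {X : Type*} {f g : X → ℝ≥0} (h : g =ᶠ[cofinite] f)
    (hg : Summable g) : Summable f := by
  rw [← NNReal.summable_coe] at hg ⊢
  exact (summable_congr_cofinite (h.mono fun x hx => congrArg NNReal.toReal hx)).1 hg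

/-- Below an envelope of infinite mass there are sources with finite support outside any given
finite set. -/
theorem exists_pmf_of_not_summable {X : Type*} {f : X → ℝ≥0} (hf : ¬ Summable f) (F : Finset X) :
    ∃ μ : PMF X, (∀ x, μ x ≤ f x) ∧ μ.support.Finite ∧ ∀ x ∈ F, μ x = 0 := by
  classical
  let g : X → ℝ≥0 := fun x => if x ∈ F then 0 else f x
  have hev : g =ᶠ[cofinite] f := by
    filter_upwards [F.finite_toSet.compl_mem_cofinite] with x hx
    have hx' : x ∉ F := hx
    simp [g, hx']
  have hg : ¬ Summable g := fun h => hf (summable_of_eventuallyEq_cofinite hev h)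
  have htop : ∑' x, (g x : ℝ≥0∞) = ⊤ := by
    by_contra h
    exact hg (ENNReal.tsum_coe_ne_top_iff_summable.1 h)
  rw [ENNReal.tsum_eq_iSup_sum] at htop
  obtain ⟨B, hB⟩ := lt_iSup_iff.1 (htop ▸ ENNReal.one_lt_top)
  have hB0 : ∑ x ∈ B, (g x : ℝ≥0∞) ≠ 0 := (zero_lt_one.trans hB).ne'
  have hBt : ∑ x ∈ B, (g x : ℝ≥0∞) ≠ ⊤ := by simp [ENNReal.sum_eq_top]
  -- The mass on `B` exceeds `1`, so normalizing only lowers the values and stays below `f`.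
  have hle : ∀ x, (g x : ℝ≥0∞) / ∑ x ∈ B, (g x : ℝ≥0∞) ≤ g x := fun x =>
    ENNReal.div_le_of_le_mul (le_mul_of_one_le_right zero_le hB.le)
  refine ⟨PMF.ofFinset (fun x => if x ∈ B then (g x : ℝ≥0∞) / ∑ x ∈ B, (g x : ℝ≥0∞) else 0) B ?_ ?_,
    fun x => ?_, ?_, fun x hx => ?_⟩
  · rw [Finset.sum_congr rfl fun x hx => if_pos hx]
    simp only [div_eq_mul_inv]
    rw [← Finset.sum_mul, ENNReal.mul_inv_cancel hB0 hBt]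
  · intro x hx
    simp [hx]
  · rw [PMF.ofFinset_apply]
    by_cases hx : x ∈ B
    · rw [if_pos hx]
      refine (hle x).trans ?_
      by_cases hxF : x ∈ F <;> simp [g, hxF]
    · simp [hx]
  · refine B.finite_toSet.subset fun x hx => ?_
    by_contra hxB
    have hxB' : x ∉ B := hxB
    exact hx (by rw [PMF.ofFinset_apply, if_neg hxB'])
  · rw [PMF.ofFinset_apply]
    simp [g, hx]

/-- Truncating a non-summable `f` at height `2 ^ (-m)` leaves it non-summable: a summable truncation
tends to `0`, hence agrees with `f` off a finite set. A source below the truncation has entropy at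
least `m`. -/
theorem summable_of_iSup_entropy_lt_top {X : Type*} {f : X → ℝ≥0}
    (h : (⨆ μ ∈ envelopeFamily f, entropy μ) < ⊤) : Summable f := by
  by_contra hf
  refine h.ne (ENNReal.eq_top_of_forall_nnreal_le fun r => ?_)
  obtain ⟨m, hm⟩ := exists_nat_ge r
  have hδ : (0 : ℝ≥0) < 2⁻¹ ^ m := by positivity
  have hg : ¬ Summable fun x => min (f x) (2⁻¹ ^ m) := fun hs => by
    have hev : (fun x => min (f x) (2⁻¹ ^ m)) =ᶠ[cofinite] f := by
      filter_upwards [(NNReal.tendsto_cofinite_zero_of_summable hs).eventually (gt_mem_nhds hδ)]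
        with x hx
      rcases min_lt_iff.1 hx with h | h
      · exact min_eq_left h.le
      · exact absurd h (lt_irrefl _)
    exact hf (summable_of_eventuallyEq_cofinite hev hs)
  obtain ⟨μ, hμ, -, -⟩ := exists_pmf_of_not_summable hg ∅
  have hμf : μ ∈ envelopeFamily f := fun x => (hμ x).trans (by
    exact_mod_cast min_le_left _ _)
  refine le_trans ?_ (le_iSup₂ (f := fun μ (_ : μ ∈ envelopeFamily f) => entropy μ) μ hμf)
  have h1 := tsum_mul_le_entropy_add μ (Z := fun _ => m) (C := 0) fun x => by
    refine (hμ x).trans ?_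
    rw [pow_zero, one_mul]
    refine (ENNReal.coe_le_coe.2 (min_le_right _ _)).trans (le_of_eq ?_)
    rw [ENNReal.coe_pow, ENNReal.coe_inv two_ne_zero]
    rfl
  rw [ENNReal.tsum_mul_right, μ.tsum_coe, one_mul, Nat.cast_zero, add_zero] at h1
  refine le_trans ?_ h1
  exact_mod_cast ENNReal.coe_le_coe.2 hm

/-- If every source below the envelope has finite entropy, the entropies are bounded: a mixture of
sources of large entropy would have infinite entropy. -/
theorem iSup_entropy_lt_top {X : Type*} {f : X → ℝ≥0}
    (h : envelopeFamily f ⊆ finiteEntropy X) : (⨆ μ ∈ envelopeFamily f, entropy μ) < ⊤ := by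
  by_contra htop
  rw [not_lt, top_le_iff] at htop
  have hex : ∀ k : ℕ, ∃ μ ∈ envelopeFamily f, (4 : ℝ≥0∞) ^ k < entropy μ := fun k => by
    have := htop ▸ (show (4 : ℝ≥0∞) ^ k < ⊤ by simp [lt_top_iff_ne_top])
    simpa only [lt_iSup_iff, exists_prop] using this
  choose ν hν hH using hex
  have hgeo : ∑' k : ℕ, (2⁻¹ : ℝ≥0∞) ^ (k + 1) = 1 := by
    simp only [pow_succ', ENNReal.tsum_mul_left]
    rw [ENNReal.tsum_geometric, ENNReal.one_sub_inv_two, inv_inv,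
      ENNReal.inv_mul_cancel (by norm_num) (by norm_num)]
  let w : PMF ℕ := ⟨fun k => 2⁻¹ ^ (k + 1), hgeo ▸ ENNReal.summable.hasSum⟩
  have hw : ∀ k, w k = 2⁻¹ ^ (k + 1) := fun k => rfl
  have hmix : w.bind ν ∈ envelopeFamily f := fun x => by
    rw [PMF.bind_apply]
    calc ∑' k, w k * ν k x ≤ ∑' k, w k * f x :=
          ENNReal.tsum_le_tsum fun k => mul_le_mul_right (hν k x) _
      _ = f x := by rw [ENNReal.tsum_mul_right, w.tsum_coe, one_mul]
  have hle : ∀ k x, w k * ν k x ≤ w.bind ν x := fun k x => by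
    rw [PMF.bind_apply]
    exact ENNReal.le_tsum (f := fun k => w k * ν k x) k
  -- Shannon lengths for the mixture serve every component. Component `k` has weight `2 ^ (-k - 1)`
  -- and, by Gibbs, mean length above `4 ^ k`, so it contributes at least `2 ^ k / 2` to the mean
  -- length `E`, for every `k`.
  obtain ⟨l, hl, hlE⟩ := exists_shannon_lengths (w.bind ν) (w.bind ν).tsum_coe
  have hfin : ∑' x, w.bind ν x * l x < ⊤ := hlE.trans_lt (ENNReal.add_lt_top.2 ⟨h hmix, by simp⟩)
  set E := ∑' x, w.bind ν x * l x
  have hbound : ∀ k : ℕ, (2 : ℝ≥0∞) ^ k ≤ 2 * E := fun k => by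
    have h1 := tsum_entTerm_add_le (ν k) (ν k).tsum_coe l 0 (by
      refine le_trans (ENNReal.tsum_mono_subtype (fun x => (2⁻¹ : ℝ≥0∞) ^ l x) ?_) (by simpa using hl)
      intro x hx h0
      have h2 := hle k x
      rw [h0, nonpos_iff_eq_zero, mul_eq_zero, hw] at h2
      exact h2.elim (by simp) hx)
    rw [Nat.cast_zero, add_zero] at h1
    have h2 : w k * 4 ^ k ≤ E :=
      calc w k * 4 ^ k ≤ w k * ∑' x, ν k x * l x := by
            gcongr
            exact (hH k).le.trans h1
        _ = ∑' x, w k * ν k x * l x := by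
            rw [← ENNReal.tsum_mul_left]
            exact tsum_congr fun x => (mul_assoc _ _ _).symm
        _ ≤ E := ENNReal.tsum_le_tsum fun x => mul_le_mul_left (hle k x) _
    calc (2 : ℝ≥0∞) ^ k = 2 * 2⁻¹ * (2 * 2⁻¹) ^ k * 2 ^ k := by
          rw [ENNReal.mul_inv_cancel (by norm_num) (by norm_num)]
          simp
      _ = 2 * (2⁻¹ ^ (k + 1) * 4 ^ k) := by
          rw [show (4 : ℝ≥0∞) ^ k = 2 ^ k * 2 ^ k by rw [← mul_pow]; norm_num]
          ring
      _ ≤ 2 * E := by gcongr; exact h2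
  obtain ⟨k, hk⟩ := ENNReal.exists_nat_gt (ENNReal.mul_lt_top (by simp) hfin : 2 * E < ⊤).ne
  have h3 : ((k : ℕ) : ℝ≥0∞) ≤ 2 ^ k := by exact_mod_cast Nat.cast_le.2 (Nat.lt_two_pow_self (n := k)).le
  exact absurd (h3.trans (hbound k)) (not_le.2 hk)

/-! ### Envelopes of infinite mass -/

/-- The Kraft sum of a code over all blocks is finite, since quantization cells have bounded
cardinality. -/
theorem tsum_length_ne_top {S : Set ℤ} {ρ : S → S → ℝ≥0} (hcons : UnboundedConsistent ρ)
    {d : ℝ≥0} {n : ℕ} (ξ : Code ρ d n) : ∑' x, (2⁻¹ : ℝ≥0∞) ^ ξ.length x ≠ ⊤ := by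
  -- Each coordinate has distortion at most `n d`. Consistency therefore confines the block, given
  -- its prototype, to a box of side `2 N + 1`.
  obtain ⟨ε, -, hε⟩ := hcons.2 (n * d + 1) (by positivity)
  obtain ⟨N, hN⟩ := exists_nat_ge ε
  have hmem : ∀ (x : Fin n → S) (i : Fin n),
      ((x i : ℤ) - ξ.quantizer x i) ∈ Finset.Icc (-(N : ℤ)) N := fun x i => by
    have hn : (0 : ℝ≥0) < n := by exact_mod_cast i.pos
    have h1 := ξ.dist_le x
    rw [blockDist, div_le_iff₀ hn, mul_comm] at h1
    have h2 : ρ (x i) (ξ.quantizer x i) ≤ n * d :=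
      (Finset.single_le_sum (f := fun i => ρ (x i) (ξ.quantizer x i)) (fun _ _ => zero_le)
        (Finset.mem_univ i)).trans h1
    have h3 : |(((x i : ℤ) : ℝ)) - ((ξ.quantizer x i : ℤ) : ℝ)| < ε := by
      by_contra h
      exact absurd ((hε _ _ h).trans h2) (not_le.2 (lt_add_one _))
    have h4 : |(x i : ℤ) - (ξ.quantizer x i : ℤ)| ≤ N := by
      have := h3.le.trans hN
      exact_mod_cast this
    rw [Finset.mem_Icc]
    exact abs_le.1 h4
  let g : (Fin n → S) → Set.range ξ.quantizer × (Fin n → Finset.Icc (-(N : ℤ)) N) := fun x =>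
    (⟨ξ.quantizer x, x, rfl⟩, fun i => ⟨_, hmem x i⟩)
  have hg : Function.Injective g := fun x x' h => by
    simp only [g, Prod.mk.injEq] at h
    funext i
    have h1 := congrArg Subtype.val (congrFun h.2 i)
    have h2 : ξ.quantizer x = ξ.quantizer x' := congrArg Subtype.val h.1
    simp only [h2] at h1
    exact Subtype.ext (by linarith)
  have h1 : ∑' x, (2⁻¹ : ℝ≥0∞) ^ ξ.length x
      ≤ ∑' p : Set.range ξ.quantizer × (Fin n → Finset.Icc (-(N : ℤ)) N),
        (2⁻¹ : ℝ≥0∞) ^ (ξ.encoder p.1).length :=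
    ENNReal.tsum_comp_le_tsum_of_injective hg fun p => (2⁻¹ : ℝ≥0∞) ^ (ξ.encoder p.1).length
  refine ne_top_of_le_ne_top ?_ h1
  rw [ENNReal.tsum_prod', ENNReal.tsum_comm]
  refine ne_top_of_le_ne_top (b := ∑' _ : Fin n → Finset.Icc (-(N : ℤ)) N, 1) ?_
    (ENNReal.tsum_le_tsum fun _ => kraft_sum_le_one ξ.encoder ξ.encoder_ne_nil ξ.prefix_free)
  rw [tsum_fintype]
  simp

theorem worstRedundancy_eq_top {S : Set ℤ} {ρ : S → S → ℝ≥0} (hρ : IsDistortion ρ)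
    (hcons : UnboundedConsistent ρ) {f : S → ℝ≥0} (hf : ¬ Summable f) {d : ℝ≥0} {n : ℕ} (hn : 1 ≤ n)
    (ξ : Code ρ d n) : ξ.worstRedundancy (envelopeFamily f) = ⊤ := by
  classical
  have hn0 : (n : ℝ≥0∞) ≠ 0 := by
    have : n ≠ 0 := by omega
    exact_mod_cast this
  refine (EReal.eq_top_iff_forall_lt _).2 fun r => ?_
  obtain ⟨M, hM⟩ := exists_nat_gt r
  refine lt_of_lt_of_le (EReal.coe_lt_coe_iff.2 hM) ?_
  -- The Kraft sum off `T` is below `2 ^ (-M n)`, so Gibbs gains `M n` bits for a source that avoids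
  -- `T`. Avoiding the first symbols of the blocks in `T` is enough.
  obtain ⟨T, hT⟩ := ((ENNReal.tendsto_tsum_compl_atTop_zero (tsum_length_ne_top hcons ξ)).eventually
    (gt_mem_nhds (show (0 : ℝ≥0∞) < 2⁻¹ ^ (M * n) from
      ENNReal.pow_pos (by simp) _))).exists
  obtain ⟨μ, hμf, hfin, hμ0⟩ := exists_pmf_of_not_summable hf
    (T.image fun x => x ⟨0, hn⟩)
  have hsupp : ∀ x ∈ T, iid μ n {x} = 0 := fun x hx => by
    rw [iid_singleton]
    exact Finset.prod_eq_zero (Finset.mem_univ ⟨0, hn⟩) (hμ0 _ (Finset.mem_image_of_mem _ hx))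
  obtain ⟨e, he⟩ := exists_injective_nat S
  have hHfin : ∑' x, entTerm (iid μ n {x}) ≠ ⊤ := by
    refine ne_top_of_le_ne_top ?_ (tsum_entTerm_iid_le μ n (tsum_two_inv_pow_succ_le_one he))
    refine ENNReal.mul_ne_top (by simp) ?_
    rw [tsum_eq_sum (s := hfin.toFinset) fun x hx => by
      have : μ x = 0 := by simpa [PMF.mem_support_iff] using hx
      simp [this]]
    rw [ENNReal.sum_ne_top]
    exact fun x _ => ENNReal.mul_ne_top (μ.apply_ne_top x) (by simp)
  have hgibbs := tsum_entTerm_add_le _ (tsum_iid_singleton μ n) ξ.length (M * n) (by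
    refine le_trans (ENNReal.tsum_mono_subtype (fun x => (2⁻¹ : ℝ≥0∞) ^ ξ.length x) ?_) hT.le
    exact fun x hx hxT => hx (hsupp x hxT))
  set H := ∑' x, entTerm (iid μ n {x})
  have hrate : (M : ℝ≥0∞) + H / n ≤ ξ.rate μ := by
    rw [Code.rate, lintegral_iid]
    refine le_trans (le_of_eq ?_) (ENNReal.div_le_div_right hgibbs _)
    rw [ENNReal.add_div, Nat.cast_mul, ENNReal.mul_div_cancel_right hn0 (by simp), add_comm]
  have hopt := optRate_le_entropy_iid hρ d n μ
  have hoptfin : optRate ρ d n μ ≠ ⊤ := ne_top_of_le_ne_top (ENNReal.div_ne_top hHfin hn0) hopt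
  refine le_trans ?_ (le_iSup₂ (f := fun μ (_ : μ ∈ envelopeFamily f) => ξ.redundancy μ) μ hμf)
  rw [Code.redundancy, EReal.le_sub_iff_add_le (Or.inl (by simp)) (Or.inl (by simpa using hoptfin))]
  have h1 : (M : ℝ≥0∞) + optRate ρ d n μ ≤ ξ.rate μ := le_trans (by gcongr) hrate
  have h2 := EReal.coe_ennreal_le_coe_ennreal_iff.2 h1
  rwa [EReal.coe_ennreal_add, ← ENNReal.ofReal_natCast, EReal.coe_ennreal_ofReal,
    max_eq_left (Nat.cast_nonneg M)] at h2

/-! ### Envelopes of finite mass -/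

/-- Taking for `k n` the largest admissible index up to `n` lets the parameter grow as fast as `P`
permits. -/
theorem exists_diagonal {P : ℕ → ℕ → Prop} (h : ∀ k, ∀ᶠ n in atTop, P k n) :
    ∃ k : ℕ → ℕ, Tendsto k atTop atTop ∧ ∀ᶠ n in atTop, P (k n) n := by
  classical
  refine ⟨fun n => Nat.findGreatest (fun k => P k n) n, tendsto_atTop.2 fun k => ?_, ?_⟩
  · filter_upwards [h k, eventually_ge_atTop k] with n hn hk
    exact Nat.le_findGreatest hk hn
  · filter_upwards [h 0] with n hn
    exact Nat.findGreatest_spec (P := fun k => P k n) (Nat.zero_le n) hn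

theorem tendsto_add_mul_log_div (A B : ℕ) :
    Tendsto (fun n : ℕ => ((A + B * (Nat.log 2 n + 1) : ℕ) : ℝ≥0∞) / n) atTop (𝓝 0) := by
  have hlog : Tendsto (fun n : ℕ => Real.log n / n) atTop (𝓝 0) :=
    (Real.isLittleO_log_id_atTop.tendsto_div_nhds_zero).comp tendsto_natCast_atTop_atTop
  have hreal : Tendsto (fun n : ℕ => ((A + B * (Nat.log 2 n + 1) : ℕ) : ℝ) / n) atTop (𝓝 0) := by
    have hlim : Tendsto (fun n : ℕ => ((A + B : ℕ) : ℝ) / n + B / Real.log 2 * (Real.log n / n))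
        atTop (𝓝 0) := by
      simpa using (tendsto_const_div_atTop_nhds_zero_nat ((A + B : ℕ) : ℝ)).add
        (hlog.const_mul (B / Real.log 2))
    refine squeeze_zero (fun n => by positivity) (fun n => ?_) hlim
    have h1 := Real.natLog_le_logb n 2
    rw [Real.logb, Nat.cast_ofNat] at h1
    calc ((A + B * (Nat.log 2 n + 1) : ℕ) : ℝ) / n
        = (((A + B : ℕ) : ℝ) + B * (Nat.log 2 n : ℝ)) / n := by
          push_cast
          ring
      _ ≤ (((A + B : ℕ) : ℝ) + B * (Real.log n / Real.log 2)) / n := by gcongr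
      _ = _ := by ring
  have h2 := ENNReal.tendsto_ofReal hreal
  rw [ENNReal.ofReal_zero] at h2
  refine h2.congr' ?_
  filter_upwards [eventually_gt_atTop 0] with n hn
  rw [ENNReal.ofReal_div_of_pos (by exact_mod_cast hn), ENNReal.ofReal_natCast,
    ENNReal.ofReal_natCast]

theorem tendsto_tsum_tail {X : Type*} [DecidableEq X] {p : X → ℝ≥0∞} {Z : X → ℕ}
    (h : ∑' a, p a * Z a ≠ ⊤) :
    Tendsto (fun W : Finset X => ∑' a, p a * (if a ∈ W then 0 else Z a : ℕ)) atTop (𝓝 0) := by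
  refine (ENNReal.tendsto_tsum_compl_atTop_zero h).congr fun W => ?_
  refine (tsum_subtype {a | a ∉ W} fun a => p a * (Z a : ℝ≥0∞)).trans (tsum_congr fun a => ?_)
  by_cases ha : a ∈ W <;> simp [ha]

theorem exists_code_fixesPrototypes {X : Type*} [Countable X] [Nonempty X] {ρ : X → X → ℝ≥0}
    (hρ : IsDistortion ρ) (d : ℝ≥0) (n : ℕ) : ∃ ξ : Code ρ d n, ξ.FixesPrototypes := by
  obtain ⟨e, he⟩ := exists_injective_nat (Fin n → X)
  obtain ⟨ξ, hξ, -⟩ := exists_code (ρ := ρ) (d := d) (id : (Fin n → X) → _)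
    (fun x => by simp [blockDist_self hρ]) (fun y => e y + 1)
    (tsum_two_inv_pow_succ_le_one (e := fun y : Set.range (id : (Fin n → X) → _) => e y)
      (he.comp Subtype.val_injective))
  refine ⟨ξ, fun y _ => by rw [hξ]; rfl⟩

/-- A scheme whose redundancy is at most a vanishing constant plus a multiple of the tail of the
expected envelope length. -/
theorem exists_scheme {X : Type*} [MeasurableSpace X] [MeasurableSingletonClass X] [Countable X]
    [Infinite X] [DecidableEq X] {ρ : X → X → ℝ≥0} (hρ : IsDistortion ρ) {Z : X → ℕ}
    (hZ : ∑' x, (2⁻¹ : ℝ≥0∞) ^ Z x ≤ 2⁻¹) {d : ℝ≥0} (hd : 0 < d) :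
    ∃ (ξ : Scheme ρ d) (W : ℕ → Finset X) (δ : ℕ → ℝ≥0∞), Tendsto W atTop atTop ∧
      Tendsto δ atTop (𝓝 0) ∧ (∀ n, (ξ n).FixesPrototypes) ∧
      ∀ᶠ n in atTop, ∀ μ : PMF X, (ξ n).rate μ ≤ optRate ρ d n μ + (δ n
        + (∑' a, μ a * (if a ∈ W n then 0 else Z a : ℕ)) * (3 + ∑' a, μ a * Z a)) := by
  obtain ⟨V, hV⟩ := exists_seq_tendsto (atTop : Filter (Finset X))
  choose s hs using fun k => Infinite.exists_notMem_finset (V k)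
  let K : ℕ → ℝ≥0 := fun k => (V k).sup fun a => ρ a (s k)
  -- The least number of copied symbols with `2 K ≤ m d`; it depends on the window but not on the
  -- block length.
  let m : ℕ → ℕ := fun k => ⌈2 * K k / d⌉₊
  let c : ℕ → ℕ := fun k => (V k).sup Z
  let cost : ℕ → ℕ → ℝ≥0∞ := fun k n =>
    ((4 + ((V k).card + 1) * (Nat.log 2 n + 1) + m k * c k : ℕ) : ℝ≥0∞) / n
  have hcost : ∀ k, Tendsto (cost k) atTop (𝓝 0) := fun k => by
    refine (tendsto_add_mul_log_div (4 + m k * c k) ((V k).card + 1)).congr fun n => ?_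
    simp only [cost]
    congr 2
    omega
  obtain ⟨k, hk, hP⟩ := exists_diagonal
    (P := fun k n => n ≠ 0 ∧ m k ≤ n ∧ cost k n ≤ ((k : ℝ≥0∞) + 1)⁻¹) fun k => by
      have hpos : (0 : ℝ≥0∞) < ((k : ℝ≥0∞) + 1)⁻¹ := by simp
      filter_upwards [eventually_ne_atTop 0, eventually_ge_atTop (m k),
        (hcost k).eventually (gt_mem_nhds hpos)] with n h1 h2 h3
      exact ⟨h1, h2, h3.le⟩
  have hm : ∀ k, 2 * K k ≤ m k * d := fun k => by
    rw [← div_le_iff₀ hd]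
    exact Nat.le_ceil _
  have hcode : ∀ n, ∃ ξ : Code ρ d n, ξ.FixesPrototypes ∧ (n ≠ 0 ∧ m (k n) ≤ n → ∀ μ : PMF X,
      ξ.rate μ ≤ optRate ρ d n μ + (cost (k n) n
        + (∑' a, μ a * (if a ∈ V (k n) then 0 else Z a : ℕ)) * (3 + ∑' a, μ a * Z a))) := fun n => by
    by_cases h : n ≠ 0 ∧ m (k n) ≤ n
    · have : NeZero n := ⟨h.1⟩
      obtain ⟨ξ, h1, h2⟩ := exists_code_rate_le hρ (hs (k n)) hZ
        (Nat.lt_pow_succ_log_self one_lt_two n) (K := K (k n)) (d := d) (m := m (k n)) (c := c (k n))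
        (fun a ha => Finset.le_sup (f := fun a => ρ a (s (k n))) ha) (hm _)
        ((hm _).trans (by gcongr; exact h.2)) h.2 (fun a ha => Finset.le_sup ha)
      exact ⟨ξ, h1, fun _ => h2⟩
    · obtain ⟨ξ, hξ⟩ := exists_code_fixesPrototypes hρ d n
      exact ⟨ξ, hξ, fun h' => absurd h' h⟩
  choose ξ hξ1 hξ2 using hcode
  refine ⟨ξ, fun n => V (k n), fun n => ((k n : ℝ≥0∞) + 1)⁻¹, hV.comp hk, ?_, hξ1, ?_⟩
  · have h1 : Tendsto (fun j : ℕ => ((j : ℝ≥0∞) + 1)⁻¹) atTop (𝓝 0) := by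
      have := (tendsto_add_atTop_iff_nat 1).2 ENNReal.tendsto_inv_nat_nhds_zero
      simpa using this
    exact h1.comp hk
  · filter_upwards [hP] with n hn μ
    refine (hξ2 n ⟨hn.1, hn.2.1⟩ μ).trans ?_
    gcongr
    exact hn.2.2

theorem redundancy_nonneg {X : Type*} [MeasurableSpace X] [MeasurableSingletonClass X] [Countable X]
    {ρ : X → X → ℝ≥0} {d : ℝ≥0} {n : ℕ} {ξ : Code ρ d n} (hξ : ξ.FixesPrototypes) {μ : PMF X}
    (hfin : optRate ρ d n μ ≠ ⊤) : 0 ≤ ξ.redundancy μ := by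
  rw [Code.redundancy, EReal.sub_nonneg (Or.inr (by simpa using hfin)) (Or.inr (by simp))]
  exact EReal.coe_ennreal_le_coe_ennreal_iff.2 (optRate_le_rate ξ hξ μ)

theorem redundancy_le {X : Type*} [MeasurableSpace X] {ρ : X → X → ℝ≥0} {d : ℝ≥0} {n : ℕ}
    {ξ : Code ρ d n} {μ : PMF X} (hfin : optRate ρ d n μ ≠ ⊤) {ε : ℝ≥0∞}
    (h : ξ.rate μ ≤ optRate ρ d n μ + ε) : ξ.redundancy μ ≤ ε := by
  rw [Code.redundancy, EReal.sub_le_iff_le_add (Or.inl (by simp)) (Or.inl (by simpa using hfin)),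
    ← EReal.coe_ennreal_add, add_comm]
  exact EReal.coe_ennreal_le_coe_ennreal_iff.2 h

theorem optRate_ne_top {X : Type*} [MeasurableSpace X] [MeasurableSingletonClass X] [Countable X]
    {ρ : X → X → ℝ≥0} (hρ : IsDistortion ρ) (d : ℝ≥0) {n : ℕ} (hn : n ≠ 0) {Z : X → ℕ}
    (hZ : ∑' x, (2⁻¹ : ℝ≥0∞) ^ Z x ≤ 1) {μ : PMF X} (hμ : ∑' a, μ a * Z a ≠ ⊤) :
    optRate ρ d n μ ≠ ⊤ :=
  ne_top_of_le_ne_top (ENNReal.div_ne_top (ne_top_of_le_ne_top (ENNReal.mul_ne_top (by simp) hμ)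
    (tsum_entTerm_iid_le μ n hZ)) (by exact_mod_cast hn)) (optRate_le_entropy_iid hρ d n μ)

/-- If the entropies below the envelope are bounded, so are the expected envelope lengths. -/
theorem tsum_envelope_mul_ne_top {X : Type*} {f : X → ℝ≥0} (hf : Summable f)
    (hne : (envelopeFamily f).Nonempty) (hfin : envelopeFamily f ⊆ finiteEntropy X) {Z : X → ℕ}
    {C : ℕ} (h : ∀ x, (f x : ℝ≥0∞) ≤ 2 ^ C * 2⁻¹ ^ Z x) : ∑' x, (f x : ℝ≥0∞) * Z x ≠ ⊤ := by
  obtain ⟨μ, hμ⟩ := hne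
  -- Some source lies below `f`, so `f` has mass at least `1` and its normalization stays below `f`.
  have hF1 : 1 ≤ ∑' x, (f x : ℝ≥0∞) := μ.tsum_coe ▸ ENNReal.tsum_le_tsum hμ
  have hF0 : ∑' x, (f x : ℝ≥0∞) ≠ 0 := (zero_lt_one.trans_le hF1).ne'
  have hFt : ∑' x, (f x : ℝ≥0∞) ≠ ⊤ := ENNReal.tsum_coe_ne_top_iff_summable.2 hf
  let p : PMF X := PMF.normalize (fun x => (f x : ℝ≥0∞)) hF0 hFt
  have hp : ∀ x, p x = f x * (∑' x, (f x : ℝ≥0∞))⁻¹ := fun x => PMF.normalize_apply _ _ x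
  have hpf : p ∈ envelopeFamily f := fun x => by
    rw [hp]
    exact mul_le_of_le_one_right zero_le (ENNReal.inv_le_one.2 hF1)
  have h1 := tsum_mul_le_entropy_add p fun x => (hpf x).trans (h x)
  have h2 : ∑' x, p x * Z x ≠ ⊤ :=
    ne_top_of_le_ne_top (ENNReal.add_ne_top.2 ⟨(hfin hpf).ne, by simp⟩) h1
  have h3 : ∑' x, (f x : ℝ≥0∞) * Z x = (∑' x, (f x : ℝ≥0∞)) * ∑' x, p x * Z x := by
    rw [← ENNReal.tsum_mul_left]
    refine tsum_congr fun x => ?_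
    rw [hp, ← mul_assoc, mul_left_comm, ENNReal.mul_inv_cancel hF0 hFt, mul_one]
  rw [h3]
  exact ENNReal.mul_ne_top hFt h2

/-- The weight `p` need not be a probability: it is a source in the weak statement and the envelope
`f` in the strong one. -/
theorem tendsto_redundancy_bound {X : Type*} [DecidableEq X] {p : X → ℝ≥0∞} {Z : X → ℕ}
    (h : ∑' a, p a * Z a ≠ ⊤) {W : ℕ → Finset X} {δ : ℕ → ℝ≥0∞} (hW : Tendsto W atTop atTop)
    (hδ : Tendsto δ atTop (𝓝 0)) :
    Tendsto (fun n => ((δ n + (∑' a, p a * (if a ∈ W n then 0 else Z a : ℕ))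
      * (3 + ∑' a, p a * Z a) : ℝ≥0∞) : EReal)) atTop (𝓝 0) := by
  have h1 := ENNReal.Tendsto.mul_const (b := 3 + ∑' a, p a * Z a) ((tendsto_tsum_tail h).comp hW)
    (Or.inr (ENNReal.add_ne_top.2 ⟨by simp, h⟩))
  have h2 := hδ.add h1
  rw [zero_mul, add_zero] at h2
  exact (continuous_coe_ennreal_ereal.tendsto _).comp h2

end Semifaithful

end
-- Assembly of the three statements
open Semifaithful in
theorem theorem3 (S : Set ℤ) (hS : S.Infinite)
    (ρ : S → S → ℝ≥0) (hρ : IsDistortion ρ) (hcons : UnboundedConsistent ρ)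
    (f : S → ℝ≥0) (hne : (envelopeFamily f).Nonempty) :
    (¬ Summable f →
      ∀ d : ℝ≥0, 0 < d → ∀ ξ : Scheme ρ d, ∀ n : ℕ, 1 ≤ n →
        (ξ n).worstRedundancy (envelopeFamily f) = ⊤) ∧
    (Summable f →
      ∀ d : ℝ≥0, 0 < d → ∃ ξ : Scheme ρ d,
        (∀ n, (ξ n).FixesPrototypes) ∧
        WeaklyMinimaxUniversal ξ (envelopeFamily f ∩ finiteEntropy S) ∧
        ((⨆ μ ∈ envelopeFamily f, entropy μ) < ⊤ →
          StronglyMinimaxUniversal ξ (envelopeFamily f))) ∧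
    ((⨆ μ ∈ envelopeFamily f, entropy μ) < ⊤ ↔ envelopeFamily f ⊆ finiteEntropy S) ∧
    ((⨆ μ ∈ envelopeFamily f, entropy μ) < ⊤ → Summable f) := by
  have hsub : (⨆ μ ∈ envelopeFamily f, entropy μ) < ⊤ → envelopeFamily f ⊆ finiteEntropy S :=
    fun h μ hμ => (le_iSup₂ (f := fun μ (_ : μ ∈ envelopeFamily f) => entropy μ) μ hμ).trans_lt h
  refine ⟨fun hf d _ ξ n hn => worstRedundancy_eq_top hρ hcons hf hn (ξ n), fun hf d hd => ?_,
    ⟨hsub, iSup_entropy_lt_top⟩, summable_of_iSup_entropy_lt_top⟩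
  classical
  have : Infinite S := hS.to_subtype
  obtain ⟨Z, C, hZ, hfZ⟩ := exists_envelope_lengths hf
  have hZ1 : ∑' x, (2⁻¹ : ℝ≥0∞) ^ Z x ≤ 1 := hZ.trans (by norm_num)
  obtain ⟨ξ, W, δ, hW, hδ, hξ, hrate⟩ := exists_scheme hρ hZ hd
  have hEZ : ∀ μ ∈ envelopeFamily f ∩ finiteEntropy S, ∑' a, μ a * Z a ≠ ⊤ := fun μ hμ =>
    ne_top_of_le_ne_top (ENNReal.add_ne_top.2 ⟨hμ.2.ne, by simp⟩)
      (tsum_mul_le_entropy_add μ fun x => (hμ.1 x).trans (hfZ x))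
  refine ⟨ξ, hξ, fun μ hμ => ?_, fun hsup => ?_⟩
  · refine tendsto_of_tendsto_of_tendsto_of_le_of_le' tendsto_const_nhds
      (tendsto_redundancy_bound (hEZ μ hμ) hW hδ) ?_ ?_
    · filter_upwards [eventually_ne_atTop 0] with n hn
      exact redundancy_nonneg (hξ n) (optRate_ne_top hρ d hn hZ1 (hEZ μ hμ))
    · filter_upwards [eventually_ne_atTop 0, hrate] with n hn hr
      exact redundancy_le (optRate_ne_top hρ d hn hZ1 (hEZ μ hμ)) (hr μ)
  · have hfin := hsub hsup
    have hE : ∑' x, (f x : ℝ≥0∞) * Z x ≠ ⊤ := tsum_envelope_mul_ne_top hf hne hfin hfZ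
    refine tendsto_of_tendsto_of_tendsto_of_le_of_le' tendsto_const_nhds
      (tendsto_redundancy_bound hE hW hδ) ?_ ?_
    · obtain ⟨μ, hμ⟩ := hne
      filter_upwards [eventually_ne_atTop 0] with n hn
      exact (redundancy_nonneg (hξ n) (optRate_ne_top hρ d hn hZ1 (hEZ μ ⟨hμ, hfin hμ⟩))).trans
        (le_iSup₂ (f := fun μ (_ : μ ∈ envelopeFamily f) => (ξ n).redundancy μ) μ hμ)
    · filter_upwards [eventually_ne_atTop 0, hrate] with n hn hr
      refine iSup₂_le fun μ hμ => ?_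
      refine redundancy_le (optRate_ne_top hρ d hn hZ1 (hEZ μ ⟨hμ, hfin hμ⟩)) ((hr μ).trans ?_)
      -- Both sums in the bound are monotone in `μ`, so the envelope gives a bound independent of
      -- the source.
      gcongr <;> exact hμ _
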